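/- Let $n\ge 1$, let $A\in\mathbb{C}^{n\times n}$ have all its eigenvalues in the open unit disc, and let $B\in\mathbb{C}^{n\times 1}$ be nonzero and such that $(A,B)$ is reachable, i.e. the vectors $B,AB,\dots,A^{n-1}B$ span $\mathbb{C}^n$. Put $G(z)=(zI-A)^{-1}B$ and, on the unit circle $\mathbb{T}$, let $G^*$ be the conjugate transpose of $G$. All integrals are over $\mathbb{T}$ with respect to the normalized Lebesgue measure $d\vartheta/2\pi$. Let $\mathcal{S}_+(\mathbb{T})$ be the set of (classes modulo a.e. equality of) real measurable functions $\Phi$ on $\mathbb{T}$ for which there are constants $0<c\le C$ with $c\le\Phi\le C$ a.e. Define $\Gamma(\Phi)=\int G\Phi G^*$ for $\Phi\in C(\mathbb{T};\mathbb{R})$, let $\operatorname{Range}\Gamma$ be the range of $\Gamma$, a real vector space of Hermitian $n\times n$ matrices, and let $P_\Gamma=\{\Sigma\in\operatorname{Range}\Gamma : \Sigma>0\}$. Fix $\Psi\in\mathcal{S}_+(\mathbb{T})$ and let $\mathbb{D}(\Psi\|\Phi)=\int\Psi\log\frac{\Psi}{\Phi}$. Then the problem $$\text{minimize } \mathbb{D}(\Psi\|\Phi)\quad\text{over}\quad\Big\{\Phi\in\mathcal{S}_+(\mathbb{T})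 : \int G\Phi G^*=\Sigma\Big\}$$ is well-posed in the sense of Hadamard for $\Sigma\in P_\Gamma$ and perturbations $\delta\Sigma\in\operatorname{Range}\Gamma$. That is: 1. for every $\Sigma\in P_\Gamma$ the problem has exactly one solution $\Phi_o(\Sigma)$; 2. for every $\Sigma\in P_\Gamma$ and every $\varepsilon>0$ there is $\delta>0$ such that for all $\delta\Sigma\in\operatorname{Range}\Gamma$ with $\|\delta\Sigma\|_F<\delta$ one has $\Sigma+\delta\Sigma\in P_\Gamma$ and $\|\Phi_o(\Sigma+\delta\Sigma)-\Phi_o(\Sigma)\|_{L^\infty}<\varepsilon$, where $\|\cdot\|_F$ is the Frobenius norm. -/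

import Mathlib

open MeasureTheory AddCircle
open scoped Real ENNReal ComplexOrder

noncomputable section

namespace SpectrumApproximation

/-- The unit circle, parametrized by the angle `θ ∈ ℝ / 2πℤ`. -/
abbrev 𝕋 : Type := AddCircle (2 * π)

instance factTwoPiPos : Fact (0 < 2 * π) := ⟨Real.two_pi_pos⟩

/-- The normalized Lebesgue measure `dθ / 2π` on the unit circle. -/
abbrev circleMeasure : Measure 𝕋 := haarAddCircle

/-- `A` is a stability matrix in the discrete-time sense: all its eigenvalues lie in the open unit
disc. -/
def IsStabilityMatrix {n : ℕ} (A : Matrix (Fin n) (Fin n) ℂ) : Prop :=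
  ∀ z ∈ spectrum ℂ A, ‖z‖ < 1

/-- `(A, B)` is reachable: the columns of `B, AB, …, A ^ (n - 1) B` span `ℂ ^ n`. -/
def IsReachable {n m : ℕ} (A : Matrix (Fin n) (Fin n) ℂ) (B : Matrix (Fin n) (Fin m) ℂ) : Prop :=
  Submodule.span ℂ
    (Set.range fun p : Fin n × Fin m => fun i => (A ^ (p.1 : ℕ) * B) i p.2) = ⊤

/-- The transfer function `G(z) = (zI - A)⁻¹ B`. -/
def transfer {n m : ℕ} (A : Matrix (Fin n) (Fin n) ℂ) (B : Matrix (Fin n) (Fin m) ℂ) (z : ℂ) :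
    Matrix (Fin n) (Fin m) ℂ :=
  (z • (1 : Matrix (Fin n) (Fin n) ℂ) - A)⁻¹ * B

/-- The matrix `∫ G Φ G*` for a scalar real function `Φ` on the unit circle, where `G*` is the
conjugate transpose of `G` on the circle; the integral is taken entrywise. -/
def moment {n : ℕ} (A : Matrix (Fin n) (Fin n) ℂ) (B : Matrix (Fin n) (Fin 1) ℂ) (Φ : 𝕋 → ℝ) :
    Matrix (Fin n) (Fin n) ℂ :=
  Matrix.of fun i j => ∫ θ, ((Φ θ : ℂ) •
    (transfer A B (toCircle θ) * (transfer A B (toCircle θ)).conjTranspose)) i j ∂circleMeasure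

/-- The range of `Γ : C(𝕋; ℝ) → ℍ(n)`, `Γ(Φ) = ∫ G Φ G*`. -/
def rangeGamma {n : ℕ} (A : Matrix (Fin n) (Fin n) ℂ) (B : Matrix (Fin n) (Fin 1) ℂ) :
    Set (Matrix (Fin n) (Fin n) ℂ) :=
  Set.range fun Φ : C(𝕋, ℝ) => moment A B Φ

/-- The set `P_Γ` of the positive definite matrices in the range of `Γ`. -/
def posRangeGamma {n : ℕ} (A : Matrix (Fin n) (Fin n) ℂ) (B : Matrix (Fin n) (Fin 1) ℂ) :
    Set (Matrix (Fin n) (Fin n) ℂ) :=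
  {S | S ∈ rangeGamma A B ∧ S.PosDef}

/-- The scalar bounded, coercive spectral densities on the unit circle, as a subset of `L^∞`. -/
def spectralDensities : Set (Lp ℝ ∞ circleMeasure) :=
  {Φ | ∃ c : ℝ, 0 < c ∧ ∀ᵐ θ ∂circleMeasure, c ≤ Φ θ}

/-- The Kullback–Leibler pseudo-distance `D(Ψ‖Φ) = ∫ Ψ log (Ψ / Φ)`. -/
def klDist (Ψ Φ : Lp ℝ ∞ circleMeasure) : ℝ :=
  ∫ θ, Ψ θ * Real.log (Ψ θ / Φ θ) ∂circleMeasure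

/-- The spectral densities `Φ` with `∫ G Φ G* = S`. -/
def feasible {n : ℕ} (A : Matrix (Fin n) (Fin n) ℂ) (B : Matrix (Fin n) (Fin 1) ℂ)
    (S : Matrix (Fin n) (Fin n) ℂ) : Set (Lp ℝ ∞ circleMeasure) :=
  {Φ | Φ ∈ spectralDensities ∧ moment A B Φ = S}

/-- `Φ` solves the problem of minimizing `D(Ψ‖Φ)` subject to `∫ G Φ G* = S`. -/
def IsKLSolution {n : ℕ} (A : Matrix (Fin n) (Fin n) ℂ) (B : Matrix (Fin n) (Fin 1) ℂ)
    (Ψ : Lp ℝ ∞ circleMeasure) (S : Matrix (Fin n) (Fin n) ℂ)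
    (Φ : Lp ℝ ∞ circleMeasure) : Prop :=
  Φ ∈ feasible A B S ∧ ∀ Φ' ∈ feasible A B S, klDist Ψ Φ ≤ klDist Ψ Φ'

end SpectrumApproximation

end

/- `‖X‖` is the Frobenius norm of a matrix `X`. -/
attribute [local instance] Matrix.frobeniusNormedAddCommGroup

/-! The minimizer is `Ψ / w`, where `w = G* Λ G` is positive on the circle and `Λ` is a multiplier
fitted to the moment constraints. Given such a `w`, optimality and uniqueness follow from `log x ≤ x
- 1` with `x = Φ w / Ψ`, since `∫ Φ w` is fixed by the constraints (`klDist_le_of_integral_mul_eq`).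

Let `W` be the finite-dimensional space of functions `Re (G* Λ G)`. A matrix `S` in the range of `Γ`
gives the functional `w ↦ ∫ Φ w` on `W`, for some continuous `Φ` of no definite sign. Reachability
makes the numerators of `v ⬝ G` exhaust the polynomials of degree less than `n`, so by Fejér–Riesz
every positive element of `W` is `|v ⬝ G|²` for some `v`. The functional then takes the value `v S
v*`, which `S > 0` makes coercive. This is how positivity of `S` replaces positivity of `Φ`.

The multiplier is found by maximizing `∫ Ψ log w` over the positive `w ∈ W` on which the functional
equals `∫ Ψ` (`exists_pos_integral_div_eq`). The danger is a maximizer with a zero. A nonnegative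
element of `W` vanishing at a point vanishes there to second order, being a limit of squares `|v ⬝
G|²` with bounded `v`; its reciprocal then has infinite integral, whereas the first-order condition
bounds that integral.

For stability, two multipliers satisfy `∫ Ψ (w - w')² / (w w') = Re tr (M T)`, where `T` is the
perturbation and `M` represents `w - w'`. All norms on `W` being equivalent, `‖w - w'‖` is at most a
constant times the size of `T`, and `Ψ / w` depends continuously on `w` in the sup norm. -/

/-! ### Fejér–Riesz factorization -/

open Polynomial ComplexConjugate in
theorem Polynomial.eval_reflect_map_conj {N : ℕ} {f : ℂ[X]} (hf : f.natDegree ≤ N) {z : ℂ}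
    (hz : z ≠ 0) :
    (reflect N (f.map (starRingEnd ℂ))).eval z = z ^ N * conj (f.eval (conj z)⁻¹) := by
  have hz' : z⁻¹ ≠ 0 := inv_ne_zero hz
  let _ : Invertible z⁻¹ := invertibleOfNonzero hz'
  have h := eval₂_reflect_mul_pow (RingHom.id ℂ) z⁻¹ N (f.map (starRingEnd ℂ))
    (natDegree_map_le.trans hf)
  have e : (⅟(z⁻¹) : ℂ) = z := by rw [invOf_eq_inv, inv_inv]
  rw [e] at h
  have h2 : (f.map (starRingEnd ℂ)).eval z⁻¹ = conj (f.eval (conj z)⁻¹) := by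
    rw [eval_map, ← eval₂_at_apply, map_inv₀, Complex.conj_conj]
  change eval z (reflect N (f.map (starRingEnd ℂ))) * z⁻¹ ^ N
    = (f.map (starRingEnd ℂ)).eval z⁻¹ at h
  rw [h2] at h
  rw [← h, inv_pow]
  field_simp

theorem Complex.conj_inv_of_norm_eq_one {z : ℂ} (hz : ‖z‖ = 1) :
    (starRingEnd ℂ z)⁻¹ = z := by
  rw [← Complex.inv_eq_conj hz, inv_inv]

theorem Complex.infinite_norm_eq_one : {z : ℂ | ‖z‖ = 1}.Infinite := by
  have h := (NormedSpace.sphere_nonempty (E := ℂ) (x := 0) (r := 1)).2 zero_le_one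
  have hc : IsPreconnected (Metric.sphere (0 : ℂ) 1) :=
    isPreconnected_sphere (by rw [Complex.rank_real_complex]; norm_num) 0 1
  have h2 : (Metric.sphere (0 : ℂ) 1).Nontrivial :=
    ⟨1, by simp, -1, by simp, by norm_num⟩
  have := hc.infinite_of_nontrivial h2
  convert this using 1
  ext; simp

open Polynomial ComplexConjugate in
/-- The Fejér–Riesz theorem for strictly positive trigonometric polynomials `z ^ (-d) * Q z`. -/
theorem Polynomial.exists_eval_eq_norm_sq_of_pos (d : ℕ) (Q : ℂ[X]) (hdeg : Q.natDegree ≤ 2 * d)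
    (hpos : ∀ z : ℂ, ‖z‖ = 1 → ∃ r : ℝ, 0 < r ∧ Q.eval z = r * z ^ d) :
    ∃ q : ℂ[X], q.natDegree ≤ d ∧
      ∀ z : ℂ, ‖z‖ = 1 → Q.eval z = ((‖q.eval z‖ ^ 2 : ℝ) : ℂ) * z ^ d := by
  induction d generalizing Q with
  | zero =>
    obtain ⟨r, hr, h1⟩ := hpos 1 (by simp)
    have hQ : Q = C (Q.coeff 0) := eq_C_of_natDegree_le_zero (by simpa using hdeg)
    rw [hQ] at h1
    simp only [eval_C, pow_zero, mul_one] at h1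
    refine ⟨C (Real.sqrt r : ℂ), by simp, fun z _ => ?_⟩
    rw [hQ]
    simp only [eval_C, pow_zero, mul_one, h1]
    rw [Complex.norm_real, Real.norm_eq_abs, sq_abs, Real.sq_sqrt hr.le]
  | succ d ih =>
    -- `z ^ (-(d + 1)) * Q z` is real on the circle, so `Q` is self-reciprocal: its roots come in
    -- pairs `z₀`, `1 / conj z₀`, and its extreme coefficients vanish together.
    have hself : reflect (2 * (d + 1)) (Q.map (starRingEnd ℂ)) = Q := by
      refine eq_of_infinite_eval_eq _ _ (Complex.infinite_norm_eq_one.mono fun z hz => ?_)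
      have hz : ‖z‖ = 1 := hz
      have hz0 : z ≠ 0 := norm_ne_zero_iff.1 (by rw [hz]; norm_num)
      obtain ⟨r, hr, h1⟩ := hpos z hz
      rw [Set.mem_ofPred_eq]
      rw [eval_reflect_map_conj hdeg hz0, Complex.conj_inv_of_norm_eq_one hz, h1, map_mul,
        map_pow, Complex.conj_ofReal, ← Complex.inv_eq_conj hz, inv_pow,
        two_mul, pow_add]
      field_simp
    by_cases hc : Q.coeff 0 = 0
    · have htop : Q.coeff (2 * (d + 1)) = 0 := by
        rw [← hself, coeff_reflect, revAt_le le_rfl, Nat.sub_self, coeff_map, hc, map_zero]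
      obtain ⟨Q1, rfl⟩ := X_dvd_iff.2 hc
      have hdeg1 : Q1.natDegree ≤ 2 * d := by
        rw [natDegree_le_iff_coeff_eq_zero]
        intro N hN
        rw [← coeff_X_mul]
        rcases (show 2 * (d + 1) = N + 1 ∨ 2 * (d + 1) < N + 1 by omega) with h | h
        · rw [← h, htop]
        · exact coeff_eq_zero_of_natDegree_lt (lt_of_le_of_lt hdeg h)
      obtain ⟨q, hq, hq'⟩ := ih Q1 hdeg1 (fun z hz => by
        obtain ⟨r, hr, h1⟩ := hpos z hz
        have hz0 : z ≠ 0 := norm_ne_zero_iff.1 (by rw [hz]; norm_num)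
        refine ⟨r, hr, mul_left_cancel₀ hz0 ?_⟩
        rw [eval_mul, eval_X] at h1
        rw [h1]; ring)
      refine ⟨q, hq.trans (Nat.le_succ d), fun z hz => ?_⟩
      rw [eval_mul, eval_X, hq' z hz]
      ring
    · have htop : Q.coeff (2 * (d + 1)) ≠ 0 := by
        rw [← hself, coeff_reflect, revAt_le le_rfl, Nat.sub_self, coeff_map]
        simpa using hc
      have hdQ : Q.degree ≠ 0 := by
        intro h
        have h' := natDegree_eq_zero_iff_degree_le_zero.2 h.le
        exact htop (coeff_eq_zero_of_natDegree_lt (by omega))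
      obtain ⟨z₀, hroot⟩ := Complex.exists_root (f := Q)
        (degree_pos_of_ne_zero_of_nonunit (by rintro rfl; simp at hc)
          (fun hu => hdQ (degree_eq_zero_of_isUnit hu)))
      have hz0 : z₀ ≠ 0 := by
        rintro rfl
        exact hc (by rw [coeff_zero_eq_eval_zero]; exact hroot)
      have hcz0 : conj z₀ ≠ 0 := by simpa using hz0
      have hn : ‖z₀‖ ≠ 1 := by
        intro h
        obtain ⟨r, hr, h1⟩ := hpos z₀ h
        rw [hroot.eq_zero] at h1
        have : (r : ℂ) * z₀ ^ (d + 1) ≠ 0 :=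
          mul_ne_zero (by exact_mod_cast hr.ne') (pow_ne_zero _ hz0)
        exact this h1.symm
      -- Strict positivity keeps roots off the circle, so the two reflected roots are distinct and
      -- both linear factors can be divided out.
      have hne : (conj z₀)⁻¹ ≠ z₀ := by
        intro h
        have h2 : z₀ * conj z₀ = 1 := by
          nth_rewrite 1 [← h]
          exact inv_mul_cancel₀ hcz0
        rw [Complex.mul_conj] at h2
        have h3 : Complex.normSq z₀ = 1 := by exact_mod_cast h2
        rw [Complex.normSq_eq_norm_sq] at h3
        exact hn (by nlinarith [norm_nonneg z₀])
      have hroot' : Q.IsRoot (conj z₀)⁻¹ := by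
        have := eval_reflect_map_conj hdeg (z := (conj z₀)⁻¹) (inv_ne_zero hcz0)
        rw [hself, map_inv₀, Complex.conj_conj, inv_inv, hroot.eq_zero, map_zero, mul_zero] at this
        exact this
      obtain ⟨Q0, rfl⟩ := dvd_iff_isRoot.2 hroot
      have hroot1 : Q0.IsRoot (conj z₀)⁻¹ := by
        rw [IsRoot, eval_mul] at hroot'
        refine (mul_eq_zero.1 hroot').resolve_left ?_
        rw [eval_sub, eval_X, eval_C]
        exact sub_ne_zero.2 hne
      obtain ⟨Q1, rfl⟩ := dvd_iff_isRoot.2 hroot1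
      have hQ1 : Q1 ≠ 0 := by rintro rfl; simp at hc
      have hd1 : Q1.natDegree ≤ 2 * d := by
        rw [natDegree_mul (X_sub_C_ne_zero _) (mul_ne_zero (X_sub_C_ne_zero _) hQ1),
          natDegree_mul (X_sub_C_ne_zero _) hQ1, natDegree_X_sub_C, natDegree_X_sub_C] at hdeg
        omega
      -- On the circle `z - 1 / conj z₀ = -(1 / conj z₀) * z * conj (z - z₀)`: the pair contributes
      -- a square modulus and one power of `z`, and the constant goes into the remaining factor.
      have key : ∀ z : ℂ, ‖z‖ = 1 →
          ((X - C z₀) * ((X - C (conj z₀)⁻¹) * Q1)).eval z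
            = ((‖z - z₀‖ ^ 2 : ℝ) : ℂ) * (z * (C (-(conj z₀)⁻¹) * Q1).eval z) := by
        intro z hz
        have hzz : conj z * z = 1 := by
          rw [mul_comm, Complex.mul_conj, Complex.normSq_eq_norm_sq, hz]; simp
        have : ((‖z - z₀‖ ^ 2 : ℝ) : ℂ) = (z - z₀) * (conj z - conj z₀) := by
          rw [← map_sub, Complex.mul_conj, Complex.normSq_eq_norm_sq]
        simp only [eval_mul, eval_sub, eval_X, eval_C]
        rw [this]
        field_simp
        linear_combination (-(z - z₀) * Q1.eval z) * (-hzz)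
      obtain ⟨q, hq, hq'⟩ := ih (C (-(conj z₀)⁻¹) * Q1)
        ((natDegree_C_mul_le _ _).trans hd1) (fun z hz => by
          obtain ⟨r, hr, h1⟩ := hpos z hz
          have hz0 : z ≠ 0 := norm_ne_zero_iff.1 (by rw [hz]; norm_num)
          have hzz : 0 < ‖z - z₀‖ := norm_pos_iff.2 (sub_ne_zero.2 (by rintro rfl; exact hn hz))
          have hzc : ((‖z - z₀‖ ^ 2 : ℝ) : ℂ) ≠ 0 := by exact_mod_cast (pow_pos hzz 2).ne'
          refine ⟨r / ‖z - z₀‖ ^ 2, by positivity, ?_⟩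
          rw [key z hz] at h1
          apply mul_left_cancel₀ hz0
          apply mul_left_cancel₀ hzc
          rw [h1]
          push_cast at hzc ⊢
          field_simp
          ring)
      refine ⟨(X - C z₀) * q, ?_, fun z hz => ?_⟩
      · refine natDegree_mul_le.trans ?_
        rw [natDegree_X_sub_C]; omega
      · rw [key z hz, hq' z hz, eval_mul, eval_sub, eval_X, eval_C, norm_mul]
        push_cast
        ring

/-! ### Numerators of the transfer function and reachability -/

namespace SpectrumApproximation

open Polynomial Matrix in
/-- The numerators of the entries of `(zI - A)⁻¹ b`, over the common denominator `A.charpoly`. -/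
noncomputable def resolventNumerator {n : ℕ} (A : Matrix (Fin n) (Fin n) ℂ) (b : Fin n → ℂ) :
    Fin n → ℂ[X] :=
  A.charmatrix.adjugate *ᵥ fun i => C (b i)

section Numerator

open Polynomial Matrix

variable {n : ℕ} (A : Matrix (Fin n) (Fin n) ℂ) (b : Fin n → ℂ)

theorem X_mul_resolventNumerator (i : Fin n) :
    X * resolventNumerator A b i
      = ∑ j, C (A i j) * resolventNumerator A b j + A.charpoly * C (b i) := by
  have h : A.charmatrix *ᵥ resolventNumerator A b = A.charpoly • fun i => C (b i) := by
    rw [resolventNumerator, mulVec_mulVec, mul_adjugate, smul_mulVec, one_mulVec]; rfl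
  have hi := congrFun h i
  simp only [mulVec, dotProduct, charmatrix_apply, sub_mul, Finset.sum_sub_distrib,
    Pi.smul_apply, smul_eq_mul, diagonal_apply, ite_mul, zero_mul, Finset.sum_ite_eq,
    Finset.mem_univ, if_true] at hi
  rw [← hi]; ring

/-- In `X p_i = ∑ A i j p_j + χ b_i`, take the `p_i` of largest degree. If that degree were at least
`n`, the left side would have larger degree than the right. -/
theorem degree_resolventNumerator_lt (i : Fin n) : (resolventNumerator A b i).degree < n := by
  obtain ⟨m, -, hm⟩ := Finset.exists_max_image Finset.univ
    (fun i => (resolventNumerator A b i).degree) ⟨i, Finset.mem_univ i⟩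
  refine lt_of_le_of_lt (hm i (Finset.mem_univ i)) ?_
  by_contra! hlt
  have hX : (X * resolventNumerator A b m).degree
      = 1 + (resolventNumerator A b m).degree := by rw [degree_mul, degree_X]
  have hne : (resolventNumerator A b m).degree ≠ ⊥ := by
    intro h; rw [h] at hlt; exact absurd hlt (by simp)
  have hle : (X * resolventNumerator A b m).degree ≤ (resolventNumerator A b m).degree := by
    rw [X_mul_resolventNumerator]
    refine (degree_add_le _ _).trans (max_le ?_ ?_)
    · refine (degree_sum_le _ _).trans (Finset.sup_le fun j _ => ?_)
      rw [← smul_eq_C_mul]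
      exact (degree_smul_le _ _).trans (hm j (Finset.mem_univ j))
    · rw [mul_comm, ← smul_eq_C_mul]
      refine (degree_smul_le _ _).trans (le_trans ?_ hlt)
      rw [charpoly_degree_eq_dim, Fintype.card_fin]
  rw [hX] at hle
  obtain ⟨d, hd⟩ := WithBot.ne_bot_iff_exists.1 hne
  rw [← hd] at hle
  have : (((1 + d : ℕ) : ℕ) : WithBot ℕ) ≤ (d : WithBot ℕ) := by push_cast; exact hle
  have : 1 + d ≤ d := WithBot.coe_le_coe.1 this
  omega

/-- The linear combination `v ↦ ∑ i, v i • resolventNumerator A b i`. -/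
noncomputable def numeratorCombination : (Fin n → ℂ) →ₗ[ℂ] degreeLT ℂ n :=
  (Fintype.linearCombination ℂ (resolventNumerator A b)).codRestrict (degreeLT ℂ n) fun v => by
    rw [Fintype.linearCombination_apply]
    exact Submodule.sum_mem _ fun i _ => Submodule.smul_mem _ _
      (mem_degreeLT.2 (degree_resolventNumerator_lt A b i))

theorem coe_numeratorCombination (v : Fin n → ℂ) :
    (numeratorCombination A b v : ℂ[X]) = ∑ i, C (v i) * resolventNumerator A b i := by
  simp [numeratorCombination, Fintype.linearCombination_apply, smul_eq_C_mul]

theorem X_mul_numeratorCombination (v : Fin n → ℂ) :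
    X * (numeratorCombination A b v : ℂ[X])
      = (numeratorCombination A b (v ᵥ* A) : ℂ[X]) + A.charpoly * C (v ⬝ᵥ b) := by
  rw [coe_numeratorCombination, coe_numeratorCombination, Finset.mul_sum]
  simp only [vecMul, dotProduct, map_sum, Finset.sum_mul, Finset.mul_sum]
  rw [Finset.sum_comm, ← Finset.sum_add_distrib]
  refine Finset.sum_congr rfl fun i _ => ?_
  rw [mul_left_comm, X_mul_resolventNumerator, mul_add, Finset.mul_sum]
  simp only [map_mul]
  congr 1
  · exact Finset.sum_congr rfl fun j _ => by ring
  · ring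

/-- If `v` is in the kernel, `χ * (v ⬝ b)` is minus a polynomial of degree less than `n`; as `χ` has
degree `n`, both terms vanish. The kernel is thus invariant under `v ↦ v A`. -/
theorem dotProduct_eq_zero_of_numeratorCombination_eq_zero {v : Fin n → ℂ}
    (hv : numeratorCombination A b v = 0) :
    v ⬝ᵥ b = 0 ∧ numeratorCombination A b (v ᵥ* A) = 0 := by
  have h := X_mul_numeratorCombination A b v
  rw [hv, ZeroMemClass.coe_zero, mul_zero] at h
  have h0 : v ⬝ᵥ b = 0 := by
    by_contra hne
    have h1 : (numeratorCombination A b (v ᵥ* A) : ℂ[X]) = -(A.charpoly * C (v ⬝ᵥ b)) :=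
      eq_neg_of_add_eq_zero_left h.symm
    have h2 := mem_degreeLT.1 (numeratorCombination A b (v ᵥ* A)).2
    rw [h1, degree_neg, degree_mul_C hne, charpoly_degree_eq_dim, Fintype.card_fin] at h2
    exact lt_irrefl _ h2
  refine ⟨h0, ?_⟩
  rw [h0, map_zero, mul_zero, add_zero] at h
  exact Subtype.ext h.symm

end Numerator

-- A kernel vector satisfies `v A ^ k B = 0` for all `k`, so reachability makes it zero;
-- surjectivity follows because both spaces have dimension `n`. Surjectivity is what turns a
-- Fejér–Riesz factor into a vector `v`.
open Polynomial Matrix in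
theorem numeratorCombination_bijective {n : ℕ} {A : Matrix (Fin n) (Fin n) ℂ}
    {B : Matrix (Fin n) (Fin 1) ℂ} (hAB : IsReachable A B) :
    Function.Bijective (numeratorCombination A fun i => B i 0) := by
  have hinj : Function.Injective (numeratorCombination A fun i => B i 0) := by
    rw [injective_iff_map_eq_zero]
    intro v hv
    have hk : ∀ k : ℕ, numeratorCombination A (fun i => B i 0) (v ᵥ* A ^ k) = 0 := by
      intro k
      induction k with
      | zero => simpa using hv
      | succ k ih =>
        rw [pow_succ, ← vecMul_vecMul]
        exact (dotProduct_eq_zero_of_numeratorCombination_eq_zero A _ ih).2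
    have hle : (⊤ : Submodule ℂ (Fin n → ℂ)) ≤ LinearMap.ker (dotProductBilin ℂ ℂ v) := by
      rw [← hAB, Submodule.span_le]
      rintro _ ⟨⟨k, l⟩, rfl⟩
      have h := (dotProduct_eq_zero_of_numeratorCombination_eq_zero A _ (hk k)).1
      rw [← dotProduct_mulVec] at h
      rw [Subsingleton.elim l 0]
      simpa [mulVec, dotProduct, mul_apply] using h
    have h := @hle (star v) trivial
    rw [LinearMap.mem_ker] at h
    exact dotProduct_self_star_eq_zero.1 h
  refine ⟨hinj, ?_⟩
  have := (degreeLTEquiv ℂ n).symm.finiteDimensional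
  refine (LinearMap.injective_iff_surjective_of_finrank_eq_finrank ?_).1 hinj
  exact (degreeLTEquiv ℂ n).symm.finrank_eq

open Polynomial Matrix in
theorem charpoly_eval_ne_zero {n : ℕ} {A : Matrix (Fin n) (Fin n) ℂ} (hA : IsStabilityMatrix A)
    {z : ℂ} (hz : ‖z‖ = 1) : A.charpoly.eval z ≠ 0 := fun h =>
  absurd (hA z (mem_spectrum_iff_isRoot_charpoly.2 h)) (by rw [hz]; exact lt_irrefl 1)

open Polynomial Matrix in
theorem isUnit_smul_one_sub {n : ℕ} {A : Matrix (Fin n) (Fin n) ℂ} (hA : IsStabilityMatrix A)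
    {z : ℂ} (hz : ‖z‖ = 1) : IsUnit (z • (1 : Matrix (Fin n) (Fin n) ℂ) - A) := by
  rw [isUnit_iff_isUnit_det, smul_one_eq_diagonal, ← scalar_apply, ← eval_charpoly]
  exact (charpoly_eval_ne_zero hA hz).isUnit

open Polynomial Matrix in
theorem transfer_apply_eq {n : ℕ} {A : Matrix (Fin n) (Fin n) ℂ} (hA : IsStabilityMatrix A)
    (B : Matrix (Fin n) (Fin 1) ℂ) {z : ℂ} (hz : ‖z‖ = 1) (i : Fin n) :
    transfer A B z i 0
      = (resolventNumerator A (fun i => B i 0) i).eval z / A.charpoly.eval z := by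
  have hχ := charpoly_eval_ne_zero hA hz
  have hdet := (isUnit_iff_isUnit_det _).1 (isUnit_smul_one_sub hA hz)
  set R : Matrix (Fin n) (Fin 1) ℂ :=
    Matrix.of fun i _ => (resolventNumerator A (fun i => B i 0) i).eval z / A.charpoly.eval z
  have hR : (z • (1 : Matrix (Fin n) (Fin n) ℂ) - A) * R = B := by
    ext i l
    rw [Subsingleton.elim l 0, Matrix.sub_mul, Matrix.smul_mul, Matrix.one_mul]
    have h := congrArg (eval z) (X_mul_resolventNumerator A (fun i => B i 0) i)
    simp only [eval_mul, eval_X, eval_add, eval_finsetSum, eval_C] at h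
    simp only [R, Matrix.sub_apply, Matrix.smul_apply, mul_apply, of_apply, smul_eq_mul, mul_div_assoc',
      ← Finset.sum_div]
    rw [h, ← sub_div, add_sub_cancel_left, mul_div_cancel_left₀ _ hχ]
  have : transfer A B z = R := by
    rw [transfer]
    nth_rewrite 1 [← hR]
    rw [nonsing_inv_mul_cancel_left _ _ hdet]
  rw [this]; rfl

/-! ### Metric and measure estimates on the circle -/

theorem norm_toCircle_sub_le (x y : 𝕋) :
    ‖(toCircle x : ℂ) - toCircle y‖ ≤ ‖x - y‖ := by
  obtain ⟨t, ht, htn⟩ : ∃ t : ℝ, (t : 𝕋) = x - y ∧ ‖x - y‖ = |t| := by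
    induction hxy : (x - y) using QuotientAddGroup.induction_on with
    | H s =>
      refine ⟨s - round ((2 * π)⁻¹ * s) * (2 * π), ?_, AddCircle.norm_eq _⟩
      have h : ((round ((2 * π)⁻¹ * s) * (2 * π) : ℝ) : 𝕋) = 0 := by
        rw [AddCircle.coe_eq_zero_iff]
        exact ⟨round ((2 * π)⁻¹ * s), by simp⟩
      rw [AddCircle.coe_sub, h, sub_zero]
  have h1 : (toCircle x : ℂ) - toCircle y = toCircle y * (toCircle (t : 𝕋) - 1) := by
    have : x = y + t := by rw [ht]; abel
    nth_rewrite 1 [this]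
    rw [toCircle_add, Circle.coe_mul]; ring
  rw [h1, norm_mul, Circle.norm_coe, one_mul, htn, toCircle_apply_mk, Circle.coe_exp,
    div_self Real.two_pi_pos.ne', one_mul, mul_comm]
  exact Real.norm_exp_I_mul_ofReal_sub_one_le

theorem exists_toCircle_eq {z : ℂ} (hz : ‖z‖ = 1) : ∃ θ : 𝕋, (toCircle θ : ℂ) = z := by
  refine ⟨(Complex.arg z : ℝ), ?_⟩
  rw [toCircle_apply_mk, div_self Real.two_pi_pos.ne', one_mul, Circle.coe_exp]
  have := Complex.norm_mul_exp_arg_mul_I z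
  rwa [hz, Complex.ofReal_one, one_mul] at this

theorem ofReal_div_pi_le_circleMeasure_closedBall (x : 𝕋) {r : ℝ} (hr : r ≤ 1) :
    ENNReal.ofReal (r / π) ≤ circleMeasure (Metric.closedBall x r) := by
  have h := AddCircle.volume_closedBall (2 * π) (x := x) r
  rw [AddCircle.volume_eq_smul_haarAddCircle, Measure.smul_apply, smul_eq_mul,
    min_eq_right (by nlinarith [Real.pi_gt_three])] at h
  rw [← ENNReal.mul_le_mul_iff_right (a := ENNReal.ofReal (2 * π))
    (by simp [Real.pi_pos]) ENNReal.ofReal_ne_top, h,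
    ← ENNReal.ofReal_mul Real.two_pi_pos.le]
  refine ENNReal.ofReal_le_ofReal (le_of_eq ?_)
  field_simp

/-- The ball of radius `r` has measure at least `r / π` and `1 / f` is at least `1 / (N r²)` on it,
so the integral exceeds `1 / (π N r)` for every small `r`. -/
theorem lintegral_inv_eq_top_of_le_sq {f : 𝕋 → ℝ} {M : ℝ} {x₀ : 𝕋}
    (hf : ∀ x, f x ≤ M * ‖x - x₀‖ ^ 2) :
    ∫⁻ x, (ENNReal.ofReal (f x))⁻¹ ∂circleMeasure = ∞ := by
  obtain ⟨N, hN, hMN⟩ : ∃ N : ℝ, 0 < N ∧ M ≤ N := ⟨max M 1, by positivity, le_max_left _ _⟩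
  have key : ∀ r : ℝ, 0 < r → r ≤ 1 → ENNReal.ofReal (1 / (π * N) / r) ≤
      ∫⁻ x, (ENNReal.ofReal (f x))⁻¹ ∂circleMeasure := by
    intro r hr hr1
    calc ENNReal.ofReal (1 / (π * N) / r)
        = (ENNReal.ofReal (N * r ^ 2))⁻¹ * ENNReal.ofReal (r / π) := by
          rw [← ENNReal.ofReal_inv_of_pos (by positivity), ← ENNReal.ofReal_mul (by positivity)]
          congr 1
          field_simp
      _ ≤ (ENNReal.ofReal (N * r ^ 2))⁻¹ * circleMeasure (Metric.closedBall x₀ r) := by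
          gcongr
          exact ofReal_div_pi_le_circleMeasure_closedBall x₀ hr1
      _ = ∫⁻ _ in Metric.closedBall x₀ r, (ENNReal.ofReal (N * r ^ 2))⁻¹ ∂circleMeasure := by
          rw [setLIntegral_const]
      _ ≤ ∫⁻ x in Metric.closedBall x₀ r, (ENNReal.ofReal (f x))⁻¹ ∂circleMeasure := by
          refine setLIntegral_mono' Metric.isClosed_closedBall.measurableSet fun x hx => ?_
          rw [ENNReal.inv_le_inv]
          refine ENNReal.ofReal_le_ofReal ((hf x).trans ?_)
          rw [mem_closedBall_iff_norm] at hx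
          gcongr
      _ ≤ _ := setLIntegral_le_lintegral _ _
  refine ENNReal.eq_top_of_forall_nnreal_le ?_
  intro K
  have hc : 0 < 1 / (π * N) := by positivity
  have hK : (0 : ℝ) < K + 1 := by positivity
  refine le_trans ?_ (key (min 1 (1 / (π * N) / (K + 1))) (by positivity) (min_le_left _ _))
  rw [← ENNReal.ofReal_coe_nnreal]
  refine ENNReal.ofReal_le_ofReal ?_
  rw [le_div_iff₀ (by positivity)]
  calc (K : ℝ) * min 1 (1 / (π * N) / (K + 1)) ≤ (K + 1) * (1 / (π * N) / (K + 1)) := by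
        gcongr
        · linarith
        · exact min_le_right _ _
    _ = 1 / (π * N) := by field_simp

/-! ### Regularity of the transfer function on the circle -/

section Transfer

open Matrix

variable {n : ℕ} {A : Matrix (Fin n) (Fin n) ℂ} (B : Matrix (Fin n) (Fin 1) ℂ)

theorem continuous_resolvent (hA : IsStabilityMatrix A) :
    Continuous fun θ : 𝕋 => ((toCircle θ : ℂ) • (1 : Matrix (Fin n) (Fin n) ℂ) - A)⁻¹ := by
  have hc : Continuous fun θ : 𝕋 => (toCircle θ : ℂ) • (1 : Matrix (Fin n) (Fin n) ℂ) - A :=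
    ((continuous_subtype_val.comp continuous_toCircle).smul continuous_const).sub continuous_const
  simp only [inv_def, Ring.inverse_eq_inv']
  refine (hc.matrix_det.inv₀ fun θ => ?_).smul hc.matrix_adjugate
  exact ((isUnit_iff_isUnit_det _).1 (isUnit_smul_one_sub hA (Circle.norm_coe _))).ne_zero

/-- The transfer function on the unit circle, as a vector. -/
noncomputable def transferVec (A : Matrix (Fin n) (Fin n) ℂ) (θ : 𝕋) : Fin n → ℂ :=
  fun i => transfer A B (toCircle θ) i 0

theorem continuous_transferVec (hA : IsStabilityMatrix A) : Continuous (transferVec B A) :=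
  continuous_pi fun i => by
    have : Continuous fun θ : 𝕋 => transfer A B (toCircle θ) :=
      (continuous_resolvent hA).matrix_mul continuous_const
    exact this.matrix_elem i 0

theorem transferVec_ne_zero (hA : IsStabilityMatrix A) (hB : B ≠ 0) (θ : 𝕋) :
    transferVec B A θ ≠ 0 := by
  intro h
  have hdet := (isUnit_iff_isUnit_det _).1
    (isUnit_smul_one_sub hA (Circle.norm_coe (toCircle θ)))
  have ht : transfer A B (toCircle θ) = 0 := by
    ext i l
    rw [Subsingleton.elim l 0]
    exact congrFun h i
  apply hB
  rw [← mul_nonsing_inv_cancel_left _ B hdet]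
  rw [transfer] at ht
  rw [ht, Matrix.mul_zero]

/-- The resolvent identity, which yields the Lipschitz bound on `v ⬝ G` by compactness. -/
theorem transferVec_sub (hA : IsStabilityMatrix A) (x y : 𝕋) :
    transferVec B A x - transferVec B A y
      = -(((toCircle x : ℂ) - toCircle y) •
        (((toCircle x : ℂ) • (1 : Matrix (Fin n) (Fin n) ℂ) - A)⁻¹ *ᵥ transferVec B A y)) := by
  have h : ∀ θ, transferVec B A θ
      = ((toCircle θ : ℂ) • (1 : Matrix (Fin n) (Fin n) ℂ) - A)⁻¹ *ᵥ fun i => B i 0 := fun θ => by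
    ext i
    simp [transferVec, transfer, mul_apply, mulVec, dotProduct]
  have hx := (isUnit_iff_isUnit_det _).1 (isUnit_smul_one_sub hA (Circle.norm_coe (toCircle x)))
  have hy := (isUnit_iff_isUnit_det _).1 (isUnit_smul_one_sub hA (Circle.norm_coe (toCircle y)))
  set P := (toCircle x : ℂ) • (1 : Matrix (Fin n) (Fin n) ℂ) - A
  set R := (toCircle y : ℂ) • (1 : Matrix (Fin n) (Fin n) ℂ) - A
  have hb : R *ᵥ transferVec B A y = fun i => B i 0 := by
    rw [h y, mulVec_mulVec, mul_nonsing_inv _ hy, one_mulVec]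
  have hPR : R = P - ((toCircle x : ℂ) - toCircle y) • (1 : Matrix (Fin n) (Fin n) ℂ) := by
    simp only [P, R, sub_smul]; abel
  rw [h x, ← hb]
  nth_rewrite 1 [hPR]
  rw [sub_mulVec, smul_mulVec, one_mulVec, mulVec_sub, mulVec_mulVec, nonsing_inv_mul _ hx,
    one_mulVec, mulVec_smul]
  abel

theorem norm_dotProduct_sq_le (v u : Fin n → ℂ) :
    ‖v ⬝ᵥ u‖ ^ 2 ≤ (∑ i, ‖v i‖ ^ 2) * ∑ i, ‖u i‖ ^ 2 := by
  calc ‖v ⬝ᵥ u‖ ^ 2 ≤ (∑ i, ‖v i‖ * ‖u i‖) ^ 2 := by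
        gcongr
        refine (norm_sum_le _ _).trans (le_of_eq ?_)
        simp
    _ ≤ _ := Finset.sum_mul_sq_le_sq_mul_sq _ _ _

theorem exists_sum_norm_sq_transferVec_le (hA : IsStabilityMatrix A) :
    ∃ K : ℝ, 0 < K ∧ ∀ θ, ∑ i, ‖transferVec B A θ i‖ ^ 2 ≤ K := by
  have hc : Continuous fun θ => ∑ i, ‖transferVec B A θ i‖ ^ 2 :=
    continuous_finsetSum _ fun i _ =>
      ((continuous_apply i).comp (continuous_transferVec B hA)).norm.pow 2
  obtain ⟨K, hK⟩ := (isCompact_range hc).bddAbove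
  exact ⟨max K 1, by positivity, fun θ => (hK ⟨θ, rfl⟩).trans (le_max_left _ _)⟩

theorem exists_norm_dotProduct_transferVec_sub_le (hA : IsStabilityMatrix A) :
    ∃ K : ℝ, 0 < K ∧ ∀ (v : Fin n → ℂ) (x y : 𝕋),
      ‖v ⬝ᵥ transferVec B A x - v ⬝ᵥ transferVec B A y‖
        ≤ K * √(∑ i, ‖v i‖ ^ 2) * ‖x - y‖ := by
  obtain ⟨G, hG0, hG⟩ := exists_sum_norm_sq_transferVec_le B hA
  have hc : Continuous fun p : 𝕋 × 𝕋 => ∑ i, ‖(((toCircle p.1 : ℂ) •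
      (1 : Matrix (Fin n) (Fin n) ℂ) - A)⁻¹ *ᵥ transferVec B A p.2) i‖ ^ 2 :=
    continuous_finsetSum _ fun i _ => ((continuous_apply i).comp
      (((continuous_resolvent hA).comp continuous_fst).matrix_mulVec
        ((continuous_transferVec B hA).comp continuous_snd))).norm.pow 2
  obtain ⟨K, hK⟩ := (isCompact_range hc).bddAbove
  refine ⟨√(max K 1), by positivity, fun v x y => ?_⟩
  rw [← dotProduct_sub, transferVec_sub B hA, dotProduct_neg, norm_neg, dotProduct_smul,
    smul_eq_mul, norm_mul, mul_comm]
  gcongr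
  · refine Real.le_sqrt_of_sq_le ((norm_dotProduct_sq_le _ _).trans ?_) |>.trans_eq
      (b := √(max K 1 * ∑ i, ‖v i‖ ^ 2)) (Real.sqrt_mul (by positivity) _)
    rw [mul_comm]
    gcongr
    exact (hK ⟨(x, y), rfl⟩).trans (le_max_left _ _)
  · exact norm_toCircle_sub_le x y

end Transfer

/-! ### The functions `Re (G* Λ G)`, their factorization and their duality with moments -/

section Quadratic

open Matrix

variable {n : ℕ} {A : Matrix (Fin n) (Fin n) ℂ} (hA : IsStabilityMatrix A)
  (B : Matrix (Fin n) (Fin 1) ℂ)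

/-- The real linear map `Λ ↦ Re (G* Λ G)` into the continuous functions on the circle. -/
noncomputable def quadraticFun : Matrix (Fin n) (Fin n) ℂ →ₗ[ℝ] C(𝕋, ℝ) where
  toFun Λ := ⟨fun θ => (star (transferVec B A θ) ⬝ᵥ Λ *ᵥ transferVec B A θ).re, by
    have := continuous_transferVec B hA
    exact Complex.continuous_re.comp
      (this.star.dotProduct (continuous_const.matrix_mulVec this))⟩
  map_add' Λ Λ' := by ext θ; simp [add_mulVec, dotProduct_add]
  map_smul' r Λ := by ext θ; simp [smul_mulVec, dotProduct_smul]

theorem quadraticFun_apply (Λ : Matrix (Fin n) (Fin n) ℂ) (θ : 𝕋) :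
    quadraticFun hA B Λ θ = (star (transferVec B A θ) ⬝ᵥ Λ *ᵥ transferVec B A θ).re := rfl

theorem quadraticFun_vecMulVec (v : Fin n → ℂ) (θ : 𝕋) :
    quadraticFun hA B (vecMulVec (star v) v) θ = ‖v ⬝ᵥ transferVec B A θ‖ ^ 2 := by
  rw [quadraticFun_apply, vecMulVec_mulVec, dotProduct_comm]
  have : star v ⬝ᵥ star (transferVec B A θ) = star (v ⬝ᵥ transferVec B A θ) := by
    rw [star_dotProduct_star, dotProduct_comm]
  rw [op_smul_eq_smul, smul_dotProduct, this, smul_eq_mul]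
  change (_ * (starRingEnd ℂ) _).re = _
  rw [Complex.mul_conj, Complex.ofReal_re, Complex.normSq_eq_norm_sq]

theorem quadraticFun_one (θ : 𝕋) :
    quadraticFun hA B 1 θ = ∑ i, ‖transferVec B A θ i‖ ^ 2 := by
  rw [quadraticFun_apply, one_mulVec, dotProduct, Complex.re_sum]
  refine Finset.sum_congr rfl fun i _ => ?_
  change ((starRingEnd ℂ) _ * _).re = _
  rw [mul_comm, Complex.mul_conj, Complex.ofReal_re, Complex.normSq_eq_norm_sq]

theorem quadraticFun_one_pos (hB : B ≠ 0) (θ : 𝕋) : 0 < quadraticFun hA B 1 θ := by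
  rw [quadraticFun_one]
  obtain ⟨i, hi⟩ := Function.ne_iff.1 (transferVec_ne_zero B hA hB θ)
  exact Finset.sum_pos' (fun _ _ => by positivity)
    ⟨i, Finset.mem_univ i, pow_pos (norm_pos_iff.2 hi) 2⟩

open Polynomial in
/-- Spectral factorization in the space of the functions `Re (G* Λ G)`. -/
theorem exists_quadraticFun_eq_norm_sq {B} (hAB : IsReachable A B) {Λ : Matrix (Fin n) (Fin n) ℂ}
    (hpos : ∀ θ, 0 < quadraticFun hA B Λ θ) :
    ∃ v : Fin n → ℂ, ∀ θ, quadraticFun hA B Λ θ = ‖v ⬝ᵥ transferVec B A θ‖ ^ 2 := by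
  obtain ⟨d, rfl⟩ : ∃ d, n = d + 1 := by
    cases n with
    | zero => exact absurd (hpos 0) (by simp [quadraticFun_apply, dotProduct])
    | succ d => exact ⟨d, rfl⟩
  set p := resolventNumerator A (fun i => B i 0)
  have hpd : ∀ i, (p i).natDegree ≤ d := fun i => by
    have := degree_resolventNumerator_lt A (fun i => B i 0) i
    exact natDegree_le_of_degree_le (Order.lt_succ_iff.1 (by exact_mod_cast this))
  have hχ : ∀ θ : 𝕋, A.charpoly.eval (toCircle θ : ℂ) ≠ 0 := fun θ =>
    charpoly_eval_ne_zero hA (Circle.norm_coe _)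
  have hpe : ∀ (θ : 𝕋) i, (p i).eval (toCircle θ : ℂ)
      = A.charpoly.eval (toCircle θ : ℂ) * transferVec B A θ i := fun θ i => by
    rw [transferVec, transfer_apply_eq hA B (Circle.norm_coe _), mul_div_cancel₀ _ (hχ θ)]
  -- On the circle `Q z = z ^ d |χ z|² Re (G* Λ G)`. The real part accounts for the Hermitian part
  -- of `Λ`, and reflection replaces the conjugated numerators by polynomials.
  set Q : ℂ[X] := ∑ i, ∑ j, C ((Λ i j + star (Λ j i)) / 2) *
    (reflect d ((p i).map (starRingEnd ℂ)) * p j) with hQ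
  have hQd : Q.natDegree ≤ 2 * d := by
    refine natDegree_sum_le_of_forall_le _ _ fun i _ => natDegree_sum_le_of_forall_le _ _
      fun j _ => (natDegree_C_mul_le _ _).trans (natDegree_mul_le.trans ?_)
    have h1 : (reflect d ((p i).map (starRingEnd ℂ))).natDegree ≤ d :=
      natDegree_reflect_le.trans (max_le le_rfl (natDegree_map_le.trans (hpd i)))
    have := hpd j
    omega
  have hQe : ∀ θ : 𝕋, Q.eval (toCircle θ : ℂ)
      = ((‖A.charpoly.eval (toCircle θ : ℂ)‖ ^ 2 * quadraticFun hA B Λ θ : ℝ) : ℂ)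
        * (toCircle θ : ℂ) ^ d := fun θ => by
    have hz : ‖(toCircle θ : ℂ)‖ = 1 := Circle.norm_coe _
    have hs : ((quadraticFun hA B Λ θ : ℝ) : ℂ) = ∑ i, ∑ j,
        (Λ i j + star (Λ j i)) / 2 * (star (transferVec B A θ i) * transferVec B A θ j) := by
      rw [quadraticFun_apply, Complex.re_eq_add_conj]
      have h1 : star (transferVec B A θ) ⬝ᵥ Λ *ᵥ transferVec B A θ
          = ∑ i, ∑ j, Λ i j * (star (transferVec B A θ i) * transferVec B A θ j) := by
        simp only [dotProduct, mulVec, Finset.mul_sum, Pi.star_apply]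
        exact Finset.sum_congr rfl fun i _ => Finset.sum_congr rfl fun j _ => by ring
      have h2 : (starRingEnd ℂ) (star (transferVec B A θ) ⬝ᵥ Λ *ᵥ transferVec B A θ)
          = ∑ i, ∑ j, star (Λ j i) * (star (transferVec B A θ i) * transferVec B A θ j) := by
        rw [h1, Finset.sum_comm]
        simp only [map_sum, map_mul]
        refine Finset.sum_congr rfl fun i _ => Finset.sum_congr rfl fun j _ => ?_
        simp only [← starRingEnd_apply, Complex.conj_conj]
        ring
      rw [h2, h1, ← Finset.sum_add_distrib, Finset.sum_div]
      refine Finset.sum_congr rfl fun i _ => ?_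
      rw [← Finset.sum_add_distrib, Finset.sum_div]
      exact Finset.sum_congr rfl fun j _ => by ring
    rw [Complex.ofReal_mul, hs, hQ, eval_finsetSum, Finset.mul_sum, Finset.sum_mul]
    refine Finset.sum_congr rfl fun i _ => ?_
    rw [eval_finsetSum, Finset.mul_sum, Finset.sum_mul]
    refine Finset.sum_congr rfl fun j _ => ?_
    rw [eval_mul, eval_mul, eval_C, eval_reflect_map_conj (hpd i) (Circle.coe_ne_zero _),
      Complex.conj_inv_of_norm_eq_one hz, hpe, hpe, map_mul, ← Complex.normSq_eq_norm_sq,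
      ← Complex.mul_conj]
    simp only [← starRingEnd_apply]
    ring
  obtain ⟨q, hqd, hq⟩ := exists_eval_eq_norm_sq_of_pos d Q hQd fun z hz => by
    obtain ⟨θ, rfl⟩ := exists_toCircle_eq hz
    exact ⟨_, mul_pos (pow_pos (norm_pos_iff.2 (hχ θ)) 2) (hpos θ), hQe θ⟩
  obtain ⟨v, hv⟩ := (numeratorCombination_bijective hAB).2 ⟨q, mem_degreeLT.2
    (lt_of_le_of_lt degree_le_natDegree (by exact_mod_cast Nat.lt_succ_of_le hqd))⟩
  refine ⟨v, fun θ => ?_⟩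
  have hqe : q.eval (toCircle θ : ℂ)
      = A.charpoly.eval (toCircle θ : ℂ) * (v ⬝ᵥ transferVec B A θ) := by
    have h := congrArg Subtype.val hv
    rw [coe_numeratorCombination] at h
    change _ = q at h
    rw [← h, eval_finsetSum, dotProduct, Finset.mul_sum]
    refine Finset.sum_congr rfl fun i _ => ?_
    rw [eval_mul, eval_C, hpe]
    ring
  have h1 := hq (toCircle θ) (Circle.norm_coe _)
  rw [hQe θ] at h1
  have h2 := mul_right_cancel₀ (pow_ne_zero d (Circle.coe_ne_zero (toCircle θ))) h1
  have h3 : ‖A.charpoly.eval (toCircle θ : ℂ)‖ ^ 2 * quadraticFun hA B Λ θ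
      = ‖q.eval (toCircle θ : ℂ)‖ ^ 2 := by exact_mod_cast h2
  rw [hqe, norm_mul, mul_pow] at h3
  exact mul_left_cancel₀ (pow_pos (norm_pos_iff.2 (hχ θ)) 2).ne' h3

theorem moment_apply (Φ : 𝕋 → ℝ) (i j : Fin n) :
    moment A B Φ i j
      = ∫ θ, (Φ θ : ℂ) * (transferVec B A θ i * star (transferVec B A θ j)) ∂circleMeasure := by
  simp [moment, transferVec, mul_apply, conjTranspose_apply]

include hA in
theorem integrable_moment_entry {Φ : 𝕋 → ℝ} (hΦ : Integrable Φ circleMeasure) (i j : Fin n) :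
    Integrable (fun θ => (Φ θ : ℂ) * (transferVec B A θ i * star (transferVec B A θ j)))
      circleMeasure := by
  have hc := continuous_transferVec B hA
  have hc' : Continuous fun θ => transferVec B A θ i * star (transferVec B A θ j) :=
    ((continuous_apply i).comp hc).mul ((continuous_apply j).comp hc).star
  obtain ⟨K, hK⟩ := (isCompact_range hc'.norm).bddAbove
  exact hΦ.ofReal.mul_bdd (c := K) hc'.aestronglyMeasurable (.of_forall fun θ => hK ⟨θ, rfl⟩)

theorem integral_mul_quadraticFun {Φ : 𝕋 → ℝ} (hΦ : Integrable Φ circleMeasure)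
    (Λ : Matrix (Fin n) (Fin n) ℂ) :
    ∫ θ, Φ θ * quadraticFun hA B Λ θ ∂circleMeasure = (Λ * moment A B Φ).trace.re := by
  have hint := fun i j => (integrable_moment_entry hA B hΦ j i).const_mul (Λ i j)
  have h1 : (Λ * moment A B Φ).trace = ∫ θ, ∑ i, ∑ j, Λ i j *
      ((Φ θ : ℂ) * (transferVec B A θ j * star (transferVec B A θ i))) ∂circleMeasure := by
    rw [integral_finsetSum _ fun i _ => integrable_finsetSum _ fun j _ => hint i j, trace]
    refine Finset.sum_congr rfl fun i _ => ?_
    rw [integral_finsetSum _ fun j _ => hint i j, diag_apply, mul_apply]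
    refine Finset.sum_congr rfl fun j _ => ?_
    rw [integral_const_mul, moment_apply]
  have h2 := Complex.reCLM.integral_comp_comm (integrable_finsetSum Finset.univ fun i _ =>
    integrable_finsetSum Finset.univ fun j _ => hint i j)
  rw [h1]
  refine Eq.trans (integral_congr_ae (.of_forall fun θ => ?_)) h2
  simp only [Complex.reCLM_apply, quadraticFun_apply]
  rw [← Complex.re_ofReal_mul]
  congr 1
  simp only [dotProduct, mulVec, Finset.mul_sum, Pi.star_apply]
  exact Finset.sum_congr rfl fun i _ => Finset.sum_congr rfl fun j _ => by ring

/-- Real parts of traces against all matrices, Hermitian or not, separate matrices: single-entry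
tests with values `1` and `I` read off each entry. -/
theorem moment_eq_iff {Φ : 𝕋 → ℝ} (hΦ : Integrable Φ circleMeasure)
    (S : Matrix (Fin n) (Fin n) ℂ) :
    moment A B Φ = S ↔
      ∀ Λ, ∫ θ, Φ θ * quadraticFun hA B Λ θ ∂circleMeasure = (Λ * S).trace.re := by
  refine ⟨fun h Λ => by rw [integral_mul_quadraticFun hA B hΦ, h], fun h => ?_⟩
  have h' : ∀ Λ : Matrix (Fin n) (Fin n) ℂ,
      (Λ * moment A B Φ).trace.re = (Λ * S).trace.re := fun Λ => by
    rw [← h, integral_mul_quadraticFun hA B hΦ]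
  ext i j
  have h1 := fun c : ℂ => h' (Matrix.single j i c)
  simp only [trace_single_mul] at h1
  apply Complex.ext
  · simpa using h1 1
  · simpa using h1 Complex.I

theorem trace_vecMulVec_mul_re (v : Fin n → ℂ) (S : Matrix (Fin n) (Fin n) ℂ) :
    (vecMulVec (star v) v * S).trace = v ⬝ᵥ S *ᵥ star v := by
  rw [vecMulVec_mul, trace_vecMulVec, dotProduct_comm, dotProduct_mulVec]

end Quadratic

/-! ### Coercivity of the moment functional and zeros of nonnegative quadratic functions -/

section Coercive

open Matrix Filter Topology

variable {n : ℕ} {A : Matrix (Fin n) (Fin n) ℂ} (hA : IsStabilityMatrix A)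
  {B : Matrix (Fin n) (Fin 1) ℂ}

/-- With `G* Λ G = |v ⬝ G|²`, the trace is `∫ Φ |v ⬝ G|²`, the quadratic form of the moment matrix
at `star v`. Only that form needs to be positive; `Φ` may change sign. -/
theorem exists_factor_sum_norm_sq_le (hAB : IsReachable A B) {Φ : 𝕋 → ℝ}
    (hΦ : Integrable Φ circleMeasure) {l : ℝ}
    (hl : ∀ v : Fin n → ℂ, l * ∑ i, ‖v i‖ ^ 2 ≤ (star v ⬝ᵥ moment A B Φ *ᵥ v).re)
    {Λ : Matrix (Fin n) (Fin n) ℂ} (hpos : ∀ θ, 0 < quadraticFun hA B Λ θ) :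
    ∃ v : Fin n → ℂ, (∀ θ, quadraticFun hA B Λ θ = ‖v ⬝ᵥ transferVec B A θ‖ ^ 2) ∧
      l * ∑ i, ‖v i‖ ^ 2 ≤ (Λ * moment A B Φ).trace.re := by
  obtain ⟨v, hv⟩ := exists_quadraticFun_eq_norm_sq hA hAB hpos
  refine ⟨v, hv, ?_⟩
  have h1 := hl (star v)
  rw [star_star, ← trace_vecMulVec_mul_re, ← integral_mul_quadraticFun hA B hΦ] at h1
  rw [← integral_mul_quadraticFun hA B hΦ]
  simp only [Pi.star_apply, norm_star, quadraticFun_vecMulVec] at h1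
  simpa only [hv] using h1

/-- Cauchy–Schwarz bounds `|v ⬝ G|²` by `K |v|²`. Factorization needs strict positivity, hence the
shift of `Λ` by `ε • 1` and the limit `ε → 0`. -/
theorem mul_norm_quadraticFun_le (hB : B ≠ 0) (hAB : IsReachable A B) {Φ : 𝕋 → ℝ}
    (hΦ : Integrable Φ circleMeasure) {l : ℝ} (hl0 : 0 ≤ l)
    (hl : ∀ v : Fin n → ℂ, l * ∑ i, ‖v i‖ ^ 2 ≤ (star v ⬝ᵥ moment A B Φ *ᵥ v).re)
    {K : ℝ} (hK : ∀ θ, ∑ i, ‖transferVec B A θ i‖ ^ 2 ≤ K)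
    {Λ : Matrix (Fin n) (Fin n) ℂ} (hnonneg : ∀ θ, 0 ≤ quadraticFun hA B Λ θ) :
    l * ‖quadraticFun hA B Λ‖ ≤ K * (Λ * moment A B Φ).trace.re := by
  have hK0 : 0 ≤ K := (Finset.sum_nonneg fun _ _ => by positivity).trans (hK 0)
  have key : ∀ ε : ℝ, 0 < ε → l * ‖quadraticFun hA B Λ + ε • quadraticFun hA B 1‖
      ≤ K * ((Λ * moment A B Φ).trace.re + ε * (moment A B Φ).trace.re) := by
    intro ε hε
    have hpos : ∀ θ, 0 < quadraticFun hA B (Λ + ε • (1 : Matrix (Fin n) (Fin n) ℂ)) θ :=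
      fun θ => by
        rw [map_add, map_smul]
        exact add_pos_of_nonneg_of_pos (hnonneg θ)
          (mul_pos hε (quadraticFun_one_pos hA B hB θ))
    obtain ⟨v, hv, hle⟩ := exists_factor_sum_norm_sq_le hA hAB hΦ hl hpos
    rw [add_mul, smul_mul, one_mul, trace_add, trace_smul, Complex.add_re, Complex.smul_re,
      smul_eq_mul] at hle
    refine le_trans ?_ (mul_le_mul_of_nonneg_left hle hK0)
    rw [mul_left_comm K]
    gcongr
    rw [← map_smul, ← map_add]
    refine (ContinuousMap.norm_le _ (by positivity)).2 fun θ => ?_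
    rw [hv, Real.norm_of_nonneg (by positivity), mul_comm K]
    refine (norm_dotProduct_sq_le _ _).trans ?_
    gcongr
    exact hK θ
  have h1 : Tendsto (fun ε : ℝ => l * ‖quadraticFun hA B Λ + ε • quadraticFun hA B 1‖)
      (𝓝[>] 0) (𝓝 (l * ‖quadraticFun hA B Λ + (0 : ℝ) • quadraticFun hA B 1‖)) :=
    ((by fun_prop : Continuous fun ε : ℝ =>
      l * ‖quadraticFun hA B Λ + ε • quadraticFun hA B 1‖).tendsto 0).mono_left
      nhdsWithin_le_nhds
  have h2 : Tendsto (fun ε : ℝ =>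
      K * ((Λ * moment A B Φ).trace.re + ε * (moment A B Φ).trace.re))
      (𝓝[>] 0) (𝓝 (K * ((Λ * moment A B Φ).trace.re + 0 * (moment A B Φ).trace.re))) :=
    ((by fun_prop : Continuous fun ε : ℝ =>
      K * ((Λ * moment A B Φ).trace.re + ε * (moment A B Φ).trace.re)).tendsto 0).mono_left
      nhdsWithin_le_nhds
  simpa using le_of_tendsto_of_tendsto h1 h2 (eventually_mem_nhdsWithin.mono key)

/-- The factor `v` of `Λ + ε • 1` stays bounded as `ε → 0`, so `v ⬝ G` is uniformly Lipschitz, while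
its modulus at `θ₀` is of order `√ε`. In the limit the square grows at most quadratically away from
`θ₀`. -/
theorem exists_quadraticFun_le_sq (hB : B ≠ 0) (hAB : IsReachable A B) {Φ : 𝕋 → ℝ}
    (hΦ : Integrable Φ circleMeasure) {l : ℝ} (hl0 : 0 < l)
    (hl : ∀ v : Fin n → ℂ, l * ∑ i, ‖v i‖ ^ 2 ≤ (star v ⬝ᵥ moment A B Φ *ᵥ v).re)
    {Λ : Matrix (Fin n) (Fin n) ℂ} (hnonneg : ∀ θ, 0 ≤ quadraticFun hA B Λ θ)
    {θ₀ : 𝕋} (hzero : quadraticFun hA B Λ θ₀ = 0) :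
    ∃ M : ℝ, ∀ θ, quadraticFun hA B Λ θ ≤ M * ‖θ - θ₀‖ ^ 2 := by
  obtain ⟨K, hK0, hK⟩ := exists_norm_dotProduct_transferVec_sub_le B hA
  set L : ℝ := (Λ * moment A B Φ).trace.re
  set L₁ : ℝ := (moment A B Φ).trace.re
  refine ⟨K ^ 2 * (√(L / l)) ^ 2, fun θ => ?_⟩
  have key : ∀ ε : ℝ, 0 < ε → quadraticFun hA B Λ θ ≤
      (√(ε * quadraticFun hA B 1 θ₀) + K * √((L + ε * L₁) / l) * ‖θ - θ₀‖) ^ 2 := by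
    intro ε hε
    have happ : ∀ θ, quadraticFun hA B (Λ + ε • (1 : Matrix (Fin n) (Fin n) ℂ)) θ
        = quadraticFun hA B Λ θ + ε * quadraticFun hA B 1 θ := fun θ => by
      rw [map_add, map_smul]; rfl
    have hone := quadraticFun_one_pos hA B hB
    obtain ⟨v, hv, hle⟩ := exists_factor_sum_norm_sq_le hA hAB hΦ hl
      (Λ := Λ + ε • (1 : Matrix (Fin n) (Fin n) ℂ)) fun θ => by
        rw [happ]; exact add_pos_of_nonneg_of_pos (hnonneg θ) (mul_pos hε (hone θ))
    rw [add_mul, smul_mul, one_mul, trace_add, trace_smul, Complex.add_re, Complex.smul_re,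
      smul_eq_mul] at hle
    have h0 : ‖v ⬝ᵥ transferVec B A θ₀‖ = √(ε * quadraticFun hA B 1 θ₀) := by
      have := hv θ₀
      rw [happ, hzero, zero_add] at this
      rw [this, Real.sqrt_sq (norm_nonneg _)]
    calc quadraticFun hA B Λ θ ≤ ‖v ⬝ᵥ transferVec B A θ‖ ^ 2 := by
          rw [← hv, happ]
          exact le_add_of_nonneg_right (mul_pos hε (hone θ)).le
      _ ≤ _ := by
          gcongr
          have h1 := norm_le_norm_add_norm_sub' (v ⬝ᵥ transferVec B A θ) (v ⬝ᵥ transferVec B A θ₀)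
          rw [h0] at h1
          refine h1.trans (add_le_add_right ((hK v θ θ₀).trans ?_) _)
          gcongr
          rw [le_div_iff₀' hl0]
          exact hle
  have h2 : Tendsto (fun ε : ℝ =>
      (√(ε * quadraticFun hA B 1 θ₀) + K * √((L + ε * L₁) / l) * ‖θ - θ₀‖) ^ 2)
      (𝓝[>] 0) (𝓝 ((√(0 * quadraticFun hA B 1 θ₀) + K * √((L + 0 * L₁) / l) * ‖θ - θ₀‖) ^ 2)) :=
    ((by fun_prop : Continuous fun ε : ℝ =>
      (√(ε * quadraticFun hA B 1 θ₀) + K * √((L + ε * L₁) / l) * ‖θ - θ₀‖) ^ 2).tendsto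
      0).mono_left nhdsWithin_le_nhds
  have h3 := ge_of_tendsto h2 (eventually_mem_nhdsWithin.mono key)
  simpa only [zero_mul, Real.sqrt_zero, zero_add, add_zero, mul_pow] using h3

theorem lintegral_inv_quadraticFun_eq_top (hB : B ≠ 0) (hAB : IsReachable A B) {Φ : 𝕋 → ℝ}
    (hΦ : Integrable Φ circleMeasure) {l : ℝ} (hl0 : 0 < l)
    (hl : ∀ v : Fin n → ℂ, l * ∑ i, ‖v i‖ ^ 2 ≤ (star v ⬝ᵥ moment A B Φ *ᵥ v).re)
    {Λ : Matrix (Fin n) (Fin n) ℂ} (hnonneg : ∀ θ, 0 ≤ quadraticFun hA B Λ θ)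
    {θ₀ : 𝕋} (hzero : quadraticFun hA B Λ θ₀ = 0) :
    ∫⁻ θ, (ENNReal.ofReal (quadraticFun hA B Λ θ))⁻¹ ∂circleMeasure = ∞ := by
  obtain ⟨M, hM⟩ := exists_quadraticFun_le_sq hA hB hAB hΦ hl0 hl hnonneg hzero
  exact lintegral_inv_eq_top_of_le_sq hM

end Coercive

/-- The smallest value of the quadratic form of a positive definite matrix on the unit sphere. -/
theorem _root_.Matrix.PosDef.exists_pos_mul_sum_norm_sq_le {n : ℕ}
    {S : Matrix (Fin n) (Fin n) ℂ} (hS : S.PosDef) :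
    ∃ l : ℝ, 0 < l ∧ ∀ v : Fin n → ℂ, l * ∑ i, ‖v i‖ ^ 2 ≤ (star v ⬝ᵥ S.mulVec v).re := by
  open Matrix in
  have hq : Continuous fun v : Fin n → ℂ => (star v ⬝ᵥ S *ᵥ v).re := by fun_prop
  have hn : Continuous fun v : Fin n → ℂ => ∑ i, ‖v i‖ ^ 2 := by fun_prop
  have hpos : ∀ v : Fin n → ℂ, v ≠ 0 → 0 < (star v ⬝ᵥ S *ᵥ v).re := fun v hv =>
    (Complex.pos_iff.1 ((posDef_iff_dotProduct_mulVec.1 hS).2 hv)).1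
  have hnpos : ∀ v : Fin n → ℂ, v ≠ 0 → 0 < ∑ i, ‖v i‖ ^ 2 := fun v hv => by
    obtain ⟨i, hi⟩ := Function.ne_iff.1 hv
    exact Finset.sum_pos' (fun _ _ => by positivity)
      ⟨i, Finset.mem_univ i, pow_pos (norm_pos_iff.2 hi) 2⟩
  -- The sphere is that of the sup norm, so the form is divided by the Euclidean square; the
  -- quotient is homogeneous of degree zero and any sphere serves. It is empty when `n = 0`.
  have hcont : ContinuousOn (fun v : Fin n → ℂ => (star v ⬝ᵥ S *ᵥ v).re / ∑ i, ‖v i‖ ^ 2)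
      (Metric.sphere 0 1) := hq.continuousOn.div hn.continuousOn fun v hv =>
        (hnpos v (ne_zero_of_mem_unit_sphere ⟨v, hv⟩)).ne'
  rcases (Metric.sphere (0 : Fin n → ℂ) 1).eq_empty_or_nonempty with he | hne
  · refine ⟨1, one_pos, fun v => ?_⟩
    have hv : v = 0 := by
      by_contra hv
      have : (‖v‖⁻¹ : ℂ) • v ∈ Metric.sphere (0 : Fin n → ℂ) 1 := by
        simp [norm_smul, hv]
      simp [he] at this
    simp [hv]
  obtain ⟨u, hu, hmin⟩ := (isCompact_sphere (0 : Fin n → ℂ) 1).exists_isMinOn hne hcont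
  have hu0 : u ≠ 0 := ne_zero_of_mem_unit_sphere ⟨u, hu⟩
  refine ⟨_, div_pos (hpos u hu0) (hnpos u hu0), fun v => ?_⟩
  rcases eq_or_ne v 0 with rfl | hv
  · simp
  have hv' : 0 < ‖v‖ := norm_pos_iff.2 hv
  have hmem : (‖v‖⁻¹ : ℂ) • v ∈ Metric.sphere (0 : Fin n → ℂ) 1 := by
    simp [norm_smul, hv]
  have h := hmin hmem
  rw [← le_div_iff₀ (hnpos v hv)]
  refine h.trans (le_of_eq ?_)
  have h1 : (star ((‖v‖⁻¹ : ℂ) • v) ⬝ᵥ S *ᵥ ((‖v‖⁻¹ : ℂ) • v)).re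
      = (‖v‖⁻¹) ^ 2 * (star v ⬝ᵥ S *ᵥ v).re := by
    rw [star_smul, mulVec_smul, smul_dotProduct, dotProduct_smul, smul_smul,
      show star (‖v‖⁻¹ : ℂ) * (‖v‖⁻¹ : ℂ) = ((‖v‖⁻¹ ^ 2 : ℝ) : ℂ) by
        rw [← starRingEnd_apply, ← Complex.ofReal_inv, Complex.conj_ofReal]; push_cast; ring,
      smul_eq_mul, Complex.re_ofReal_mul]
  have h2 : ∑ i, ‖((‖v‖⁻¹ : ℂ) • v) i‖ ^ 2 = (‖v‖⁻¹) ^ 2 * ∑ i, ‖v i‖ ^ 2 := by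
    rw [Finset.mul_sum]
    refine Finset.sum_congr rfl fun i _ => ?_
    simp [mul_pow]
  simp only [h1, h2]
  rw [mul_div_mul_left _ _ (by positivity)]

end SpectrumApproximation

/-! ### Maximization of the weighted logarithm over a finite-dimensional space -/

section LogBarrier

open Filter Topology

variable {X : Type*} [TopologicalSpace X] [CompactSpace X] {W : Submodule ℝ C(X, ℝ)}
  [FiniteDimensional ℝ W]

theorem Submodule.isCompact_inter_norm_le (R : ℝ) :
    IsCompact {w : C(X, ℝ) | w ∈ W ∧ ‖w‖ ≤ R} := by
  have := FiniteDimensional.proper ℝ W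
  suffices h : {w : C(X, ℝ) | w ∈ W ∧ ‖w‖ ≤ R} = Subtype.val '' Metric.closedBall (0 : W) R by
    rw [h]
    exact (isCompact_closedBall (0 : W) R).image continuous_subtype_val
  ext w
  simp only [Set.mem_ofPred_eq, Set.mem_image, mem_closedBall_zero_iff]
  exact ⟨fun h => ⟨⟨w, h.1⟩, h.2, rfl⟩, by rintro ⟨w, hw, rfl⟩; exact ⟨w.2, hw⟩⟩

variable [MeasurableSpace X] [BorelSpace X] {μ : Measure X}

/-- A uniform lower bound for the nonnegative elements of a finite-dimensional space of continuous
functions whose reciprocals have bounded integral. -/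
theorem exists_pos_le_of_lintegral_inv_le
    (H : ∀ w ∈ W, (∀ x, 0 ≤ w x) → ∀ x₀, w x₀ = 0 → ∫⁻ x, (ENNReal.ofReal (w x))⁻¹ ∂μ = ∞)
    (R : ℝ) {M : ℝ≥0∞} (hM : M ≠ ∞) :
    ∃ δ : ℝ, 0 < δ ∧ ∀ w ∈ W, ‖w‖ ≤ R → (∀ x, 0 ≤ w x) →
      ∫⁻ x, (ENNReal.ofReal (w x))⁻¹ ∂μ ≤ M → ∀ x, δ ≤ w x := by
  set T : Set C(X, ℝ) := {w | w ∈ W ∧ ‖w‖ ≤ R} ∩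
    ({w | ∀ x, 0 ≤ w x} ∩ {w | ∫⁻ x, (ENNReal.ofReal (w x))⁻¹ ∂μ ≤ M})
  have hclosed1 : IsClosed {w : C(X, ℝ) | ∀ x, 0 ≤ w x} := by
    have : {w : C(X, ℝ) | ∀ x, 0 ≤ w x} = ⋂ x, {w | 0 ≤ w x} := by ext; simp
    rw [this]
    exact isClosed_iInter fun x => isClosed_le continuous_const (continuous_eval_const x)
  -- The reciprocals may blow up, so only lower semicontinuity is available; Fatou's lemma supplies
  -- it.
  have hclosed2 : IsClosed {w : C(X, ℝ) | ∫⁻ x, (ENNReal.ofReal (w x))⁻¹ ∂μ ≤ M} := by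
    refine IsSeqClosed.isClosed fun u w hu huw => ?_
    have hpt : ∀ x, Tendsto (fun k => (ENNReal.ofReal (u k x))⁻¹) atTop
        (𝓝 (ENNReal.ofReal (w x))⁻¹) := fun x =>
      (continuous_inv.tendsto _).comp ((ENNReal.continuous_ofReal.tendsto _).comp
        (((continuous_eval_const x).tendsto w).comp huw))
    calc ∫⁻ x, (ENNReal.ofReal (w x))⁻¹ ∂μ
        = ∫⁻ x, liminf (fun k => (ENNReal.ofReal (u k x))⁻¹) atTop ∂μ := by
          simp only [(hpt _).liminf_eq]
      _ ≤ liminf (fun k => ∫⁻ x, (ENNReal.ofReal (u k x))⁻¹ ∂μ) atTop :=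
          lintegral_liminf_le fun k => (u k).continuous.measurable.ennreal_ofReal.inv
      _ ≤ M := liminf_le_of_frequently_le' (Frequently.of_forall hu)
  have hTc : IsCompact T := (W.isCompact_inter_norm_le R).inter_right (hclosed1.inter hclosed2)
  have hcont : Continuous fun p : C(X, ℝ) × X => p.1 p.2 := ContinuousEval.continuous_eval
  rcases (T ×ˢ (Set.univ : Set X)).eq_empty_or_nonempty with he | hne
  · refine ⟨1, one_pos, fun w hw hR h0 hi x => ?_⟩
    have : (w, x) ∈ T ×ˢ (Set.univ : Set X) := ⟨⟨⟨hw, hR⟩, h0, hi⟩, trivial⟩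
    rw [he] at this
    exact this.elim
  · obtain ⟨⟨w₀, x₀⟩, ⟨⟨⟨hw, hR⟩, h0, hi⟩, -⟩, hmin⟩ :=
      (hTc.prod isCompact_univ).exists_isMinOn hne hcont.continuousOn
    refine ⟨w₀ x₀, lt_of_le_of_ne (h0 x₀) fun h => hM (top_le_iff.1 ?_), fun w hw hR h0 hi x => ?_⟩
    · rw [← H w₀ hw h0 x₀ h.symm]; exact hi
    · exact hmin (a := (w, x)) ⟨⟨⟨hw, hR⟩, h0, hi⟩, trivial⟩

variable {Ψ : X → ℝ}

theorem ContinuousMap.integrable_mul (hΨ : Integrable Ψ μ) (u : C(X, ℝ)) :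
    Integrable (fun x => Ψ x * u x) μ :=
  hΨ.mul_bdd (c := ‖u‖) u.continuous.measurable.aestronglyMeasurable
    (.of_forall fun x => u.norm_coe_le_norm x)

/-- Integration against an integrable weight, as a functional on continuous functions. -/
noncomputable def ContinuousMap.integralMul (hΨ : Integrable Ψ μ) : C(X, ℝ) →L[ℝ] ℝ :=
  LinearMap.mkContinuous
    { toFun := fun u => ∫ x, Ψ x * u x ∂μ
      map_add' := fun u v => by
        rw [← integral_add (u.integrable_mul hΨ) (v.integrable_mul hΨ)]
        simp only [add_apply, mul_add]
      map_smul' := fun r u => by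
        rw [RingHom.id_apply, smul_eq_mul, ← integral_const_mul]
        refine integral_congr_ae (.of_forall fun x => ?_)
        simp only [smul_apply, smul_eq_mul]
        ring } (∫ x, |Ψ x| ∂μ) fun u => by
    rw [← integral_mul_const]
    refine norm_integral_le_of_norm_le (hΨ.abs.mul_const _) (.of_forall fun x => ?_)
    rw [norm_mul, Real.norm_eq_abs]
    gcongr
    exact u.norm_coe_le_norm x

theorem ContinuousMap.integralMul_apply (hΨ : Integrable Ψ μ) (u : C(X, ℝ)) :
    integralMul hΨ u = ∫ x, Ψ x * u x ∂μ := rfl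

/-- The logarithm, truncated below `η`. -/
noncomputable def Real.truncatedLog {η : ℝ} (hη : 0 < η) : C(ℝ, ℝ) :=
  ⟨fun x => Real.log (max x η), (continuous_id.max continuous_const).log fun _ =>
    (lt_max_of_lt_right hη).ne'⟩

/-- The reciprocal, truncated below `η`. -/
noncomputable def Real.truncatedInv {η : ℝ} (hη : 0 < η) : C(ℝ, ℝ) :=
  ⟨fun x => (max x η)⁻¹, (continuous_id.max continuous_const).inv₀ fun _ =>
    (lt_max_of_lt_right hη).ne'⟩

theorem Real.truncatedLog_apply {η : ℝ} (hη : 0 < η) {x : ℝ} (hx : η ≤ x) :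
    truncatedLog hη x = Real.log x := by
  change Real.log (max x η) = _
  rw [max_eq_left hx]

theorem Real.truncatedInv_apply {η : ℝ} (hη : 0 < η) {x : ℝ} (hx : η ≤ x) :
    truncatedInv hη x = x⁻¹ := by
  change (max x η)⁻¹ = _
  rw [max_eq_left hx]

/-- The first-order condition at a maximizer of the weighted logarithmic integral. -/
theorem integral_mul_truncatedInv_nonpos (hΨ : Integrable Ψ μ) (hΨ0 : ∀ᵐ x ∂μ, 0 ≤ Ψ x)
    {η : ℝ} (hη : 0 < η) {w u : C(X, ℝ)} (hw : ∀ x, η ≤ w x) (hu : ∀ x, η ≤ u x)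
    (hmax : ∀ t : ℝ, 0 < t → t ≤ 1 →
      ∫ x, Ψ x * (Real.truncatedLog hη).comp (w + t • (u - w)) x ∂μ
        ≤ ∫ x, Ψ x * (Real.truncatedLog hη).comp w x ∂μ) :
    ∫ x, Ψ x * ((u - w) * (Real.truncatedInv hη).comp w) x ∂μ ≤ 0 := by
  have hcont : Continuous fun t : ℝ => ContinuousMap.integralMul hΨ
      ((u - w) * (Real.truncatedInv hη).comp (w + t • (u - w))) :=
    (ContinuousMap.integralMul hΨ).continuous.comp (continuous_const.mul
      ((ContinuousMap.continuous_postcomp _).comp (by fun_prop)))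
  have hlim := (hcont.tendsto 0).mono_left (nhdsWithin_le_nhds (s := Set.Ioi 0))
  simp only [zero_smul, add_zero] at hlim
  refine le_of_tendsto hlim ?_
  filter_upwards [Ioc_mem_nhdsGT (zero_lt_one' ℝ)] with t ht
  have hwt : ∀ x, η ≤ (w + t • (u - w)) x := fun x => by
    simp only [ContinuousMap.add_apply, ContinuousMap.smul_apply, ContinuousMap.sub_apply,
      smul_eq_mul]
    nlinarith [hw x, hu x, ht.1, ht.2, mul_nonneg ht.1.le (sub_nonneg.2 (hu x)),
      mul_nonneg (sub_nonneg.2 ht.2) (sub_nonneg.2 (hw x))]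
  -- Concavity in the form `log y - log x ≥ (y - x) / y` puts the reciprocal at the moved point;
  -- letting `t → 0` moves it back to `w` by sup-norm continuity alone.
  have h1 : t * ContinuousMap.integralMul hΨ
      ((u - w) * (Real.truncatedInv hη).comp (w + t • (u - w)))
      ≤ ContinuousMap.integralMul hΨ ((Real.truncatedLog hη).comp (w + t • (u - w))
        - (Real.truncatedLog hη).comp w) := by
    rw [← smul_eq_mul, ← map_smul, ContinuousMap.integralMul_apply,
      ContinuousMap.integralMul_apply]
    refine integral_mono_ae (ContinuousMap.integrable_mul hΨ _)
      (ContinuousMap.integrable_mul hΨ _) ?_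
    filter_upwards [hΨ0] with x hx
    refine mul_le_mul_of_nonneg_left ?_ hx
    have hwx := hw x
    have hwtx := hwt x
    simp only [ContinuousMap.smul_apply, ContinuousMap.mul_apply, ContinuousMap.sub_apply,
      ContinuousMap.comp_apply]
    rw [Real.truncatedInv_apply hη hwtx, Real.truncatedLog_apply hη hwtx,
      Real.truncatedLog_apply hη hwx]
    have hw0 : 0 < w x := hη.trans_le hwx
    have hwt0 : 0 < (w + t • (u - w)) x := hη.trans_le hwtx
    have h := Real.one_sub_inv_le_log_of_pos (div_pos hwt0 hw0)
    rw [Real.log_div hwt0.ne' hw0.ne', inv_div] at h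
    refine le_trans (le_of_eq ?_) h
    have e : t * (u x - w x) = (w + t • (u - w)) x - w x := by simp
    rw [smul_eq_mul, ← mul_assoc, e]
    field_simp
  rw [map_sub] at h1
  have h2 := h1.trans (sub_nonpos.2 (hmax t ht.1 ht.2))
  by_contra! h3
  exact absurd h2 (not_le.2 (mul_pos ht.1 h3))

/-- Existence of a positive element `w` of `W` such that the weight `Ψ / w` represents a given
coercive functional on `W`. -/
theorem exists_pos_integral_div_eq [IsProbabilityMeasure μ] (hΨ : Integrable Ψ μ) {a : ℝ}
    (ha : 0 < a) (hΨa : ∀ᵐ x ∂μ, a ≤ Ψ x)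
    (H : ∀ w ∈ W, (∀ x, 0 ≤ w x) → ∀ x₀, w x₀ = 0 → ∫⁻ x, (ENNReal.ofReal (w x))⁻¹ ∂μ = ∞)
    {w₀ : C(X, ℝ)} (hw₀ : w₀ ∈ W) (hw₀pos : ∀ x, 0 < w₀ x)
    (L : C(X, ℝ) →L[ℝ] ℝ) {c : ℝ} (hc : 0 < c)
    (hL : ∀ w ∈ W, (∀ x, 0 ≤ w x) → c * ‖w‖ ≤ L w) :
    ∃ w ∈ W, (∀ x, 0 < w x) ∧ ∀ u ∈ W, ∫ x, Ψ x * (u x / w x) ∂μ = L u := by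
  have hX : Nonempty X := nonempty_of_isProbabilityMeasure μ
  have hΨ0 : ∀ᵐ x ∂μ, 0 ≤ Ψ x := hΨa.mono fun x hx => ha.le.trans hx
  set m : ℝ := ∫ x, Ψ x ∂μ with hm
  have hm0 : 0 < m := by
    have : ∫ _ : X, a ∂μ ≤ m := integral_mono_ae (integrable_const a) hΨ hΨa
    simp only [integral_const, probReal_univ, one_smul] at this
    exact ha.trans_le this
  have hLw₀ : 0 < L w₀ := by
    refine lt_of_lt_of_le (mul_pos hc (norm_pos_iff.2 ?_)) (hL w₀ hw₀ fun x => (hw₀pos x).le)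
    rintro rfl
    exact lt_irrefl _ (hw₀pos hX.some)
  -- normalize the positive element
  set w₁ : C(X, ℝ) := (m / L w₀) • w₀ with hw₁def
  have hw₁ : w₁ ∈ W := W.smul_mem _ hw₀
  have hLw₁ : L w₁ = m := by
    rw [hw₁def, map_smul, smul_eq_mul, div_mul_cancel₀ _ hLw₀.ne']
  obtain ⟨β, hβ, hβw⟩ : ∃ β : ℝ, 0 < β ∧ ∀ x, β ≤ w₁ x := by
    obtain ⟨x₀, -, hx₀⟩ := isCompact_univ.exists_isMinOn (Set.univ_nonempty (α := X))
      w₁.continuous.continuousOn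
    exact ⟨w₁ x₀, mul_pos (div_pos hm0 hLw₀) (hw₀pos x₀), fun x => hx₀ (Set.mem_univ x)⟩
  -- `m / c` bounds the norm on the slice `L w = m`; `m / (β * a)` is the bound on `∫ 1 / w` that
  -- the first-order condition tested at `w₁` will give.
  obtain ⟨δ, hδ, hδle⟩ := exists_pos_le_of_lintegral_inv_le H (m / c)
    (M := ENNReal.ofReal (m / (β * a))) ENNReal.ofReal_ne_top
  -- `β` keeps `w₁` admissible; `δ / 2` makes the constraint `η ≤ w` inactive once the maximizer is
  -- known to be at least `δ`.
  set η : ℝ := min (δ / 2) β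
  have hη : 0 < η := by positivity
  set K : Set C(X, ℝ) := {w | w ∈ W ∧ ‖w‖ ≤ m / c} ∩ ({w | ∀ x, η ≤ w x} ∩ {w | L w = m})
  have hKmem : ∀ w ∈ W, (∀ x, η ≤ w x) → L w = m → w ∈ K := fun w hw h1 h2 =>
    ⟨⟨hw, by
      rw [le_div_iff₀' hc, ← h2]; exact hL w hw fun x => hη.le.trans (h1 x)⟩, h1, h2⟩
  have hKc : IsCompact K := by
    refine (W.isCompact_inter_norm_le _).inter_right (IsClosed.inter ?_ ?_)
    · have : {w : C(X, ℝ) | ∀ x, η ≤ w x} = ⋂ x, {w | η ≤ w x} := by ext; simp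
      rw [this]
      exact isClosed_iInter fun x => isClosed_le continuous_const (continuous_eval_const x)
    · exact isClosed_eq L.continuous continuous_const
  have hf : Continuous fun w : C(X, ℝ) =>
      ContinuousMap.integralMul hΨ ((Real.truncatedLog hη).comp w) :=
    (ContinuousMap.integralMul hΨ).continuous.comp (ContinuousMap.continuous_postcomp _)
  have hw₁K : w₁ ∈ K := hKmem w₁ hw₁ (fun x => (min_le_right _ _).trans (hβw x)) hLw₁
  obtain ⟨w, hwK, hwmax⟩ := hKc.exists_isMaxOn ⟨w₁, hw₁K⟩ hf.continuousOn
  obtain ⟨⟨hwW, hwR⟩, hwη, hwL⟩ := hwK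
  have hinv : ∀ x, (Real.truncatedInv hη).comp w x = (w x)⁻¹ := fun x =>
    Real.truncatedInv_apply hη (hwη x)
  have hvar : ∀ u ∈ K, ContinuousMap.integralMul hΨ
      ((u - w) * (Real.truncatedInv hη).comp w) ≤ 0 := by
    rintro u ⟨⟨huW, -⟩, huη, huL⟩
    refine integral_mul_truncatedInv_nonpos hΨ hΨ0 hη hwη huη fun t ht0 ht1 => ?_
    refine hwmax (hKmem _ (W.add_mem hwW (W.smul_mem _ (W.sub_mem huW hwW))) (fun x => ?_) ?_)
    · simp only [ContinuousMap.add_apply, ContinuousMap.smul_apply, ContinuousMap.sub_apply,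
        smul_eq_mul]
      nlinarith [mul_nonneg ht0.le (sub_nonneg.2 (huη x)),
        mul_nonneg (sub_nonneg.2 ht1) (sub_nonneg.2 (hwη x))]
    · rw [map_add, map_smul, map_sub]
      have h1 : L u = m := huL
      have h2 : L w = m := hwL
      rw [h1, h2, sub_self, smul_zero, add_zero]
  have hself : ContinuousMap.integralMul hΨ (w * (Real.truncatedInv hη).comp w) = m := by
    rw [ContinuousMap.integralMul_apply, hm]
    refine integral_congr_ae (.of_forall fun x => ?_)
    simp only [ContinuousMap.mul_apply, hinv]
    rw [mul_inv_cancel₀ (hη.trans_le (hwη x)).ne', mul_one]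
  -- the maximizer is in the interior
  have hwδ : ∀ x, δ ≤ w x := by
    refine hδle w hwW hwR (fun x => hη.le.trans (hwη x)) ?_
    have h1 := hvar w₁ hw₁K
    rw [sub_mul, map_sub, hself, sub_nonpos, ContinuousMap.integralMul_apply] at h1
    have h2 : ∫ x, β * a * (w x)⁻¹ ∂μ ≤ m := by
      refine le_trans (integral_mono_of_nonneg (.of_forall fun x => ?_)
        (ContinuousMap.integrable_mul hΨ _) ?_) h1
      · have := hη.trans_le (hwη x); positivity
      · filter_upwards [hΨa] with x hx
        rw [ContinuousMap.mul_apply, hinv, ← mul_assoc, mul_comm β]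
        have := hη.trans_le (hwη x)
        gcongr
        · exact ha.le.trans hx
        · exact hβw x
    have h3 : Integrable (fun x => (w x)⁻¹) μ := by
      have := ContinuousMap.integrable_mul (integrable_const (1 : ℝ))
        ((Real.truncatedInv hη).comp w) (μ := μ)
      simpa only [hinv, one_mul] using this
    rw [integral_const_mul, ← le_div_iff₀' (by positivity)] at h2
    calc ∫⁻ x, (ENNReal.ofReal (w x))⁻¹ ∂μ = ∫⁻ x, ENNReal.ofReal ((w x)⁻¹) ∂μ :=
          lintegral_congr fun x => (ENNReal.ofReal_inv_of_pos (hη.trans_le (hwη x))).symm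
      _ = ENNReal.ofReal (∫ x, (w x)⁻¹ ∂μ) :=
          (ofReal_integral_eq_lintegral_ofReal h3 (.of_forall fun x =>
            (inv_pos.2 (hη.trans_le (hwη x))).le)).symm
      _ ≤ _ := ENNReal.ofReal_le_ofReal h2
  have hzero : ∀ v ∈ W, L v = 0 →
      ContinuousMap.integralMul hΨ (v * (Real.truncatedInv hη).comp w) ≤ 0 := by
    intro v hv hv0
    -- The perturbation `t • v` is at most `η` in absolute value, and `w ≥ δ ≥ 2 η`, so `w + t • v`
    -- is still admissible.
    set t : ℝ := η / (‖v‖ + 1)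
    have ht : 0 < t := by positivity
    have htv : ∀ x, |t * v x| ≤ η := fun x => by
      rw [abs_mul, abs_of_pos ht, div_mul_eq_mul_div, div_le_iff₀ (by positivity)]
      gcongr
      exact (v.norm_coe_le_norm x).trans (by linarith)
    have h1 := hvar (w + t • v) (hKmem _ (W.add_mem hwW (W.smul_mem _ hv)) (fun x => by
      have h2 := (abs_le.1 (htv x)).1
      have h3 := hwδ x
      have h4 : η ≤ δ / 2 := min_le_left _ _
      simp only [ContinuousMap.add_apply, ContinuousMap.smul_apply, smul_eq_mul]
      linarith) (by rw [map_add, map_smul, hv0, smul_zero, add_zero]; exact hwL))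
    rw [add_sub_cancel_left, smul_mul_assoc, map_smul, smul_eq_mul] at h1
    by_contra! h5
    exact absurd h1 (not_le.2 (mul_pos ht h5))
  refine ⟨w, hwW, fun x => hη.trans_le (hwη x), fun u hu => ?_⟩
  have heq : ∫ x, Ψ x * (u x / w x) ∂μ
      = ContinuousMap.integralMul hΨ (u * (Real.truncatedInv hη).comp w) := by
    rw [ContinuousMap.integralMul_apply]
    refine integral_congr_ae (.of_forall fun x => ?_)
    simp only [ContinuousMap.mul_apply, hinv]
    rw [div_eq_mul_inv]
  rw [heq]
  -- `∫ Ψ v / w` vanishes on the kernel of `L`, hence is a multiple of `L` on `W`; both equal `m` at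
  -- `w`, so the multiple is one.
  set v : C(X, ℝ) := u - (L u / m) • w
  have hvW : v ∈ W := W.sub_mem hu (W.smul_mem _ hwW)
  have hvL : L v = 0 := by
    have h2 : L w = m := hwL
    rw [map_sub, map_smul, h2, smul_eq_mul, div_mul_cancel₀ _ hm0.ne', sub_self]
  have h1 := hzero v hvW hvL
  have h2 := hzero (-v) (W.neg_mem hvW) (by rw [map_neg, hvL, neg_zero])
  rw [neg_mul, map_neg, neg_nonpos] at h2
  have h3 := le_antisymm h1 h2
  rw [sub_mul, map_sub, smul_mul_assoc, map_smul, hself, smul_eq_mul,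
    div_mul_cancel₀ _ hm0.ne', sub_eq_zero] at h3
  exact h3

end LogBarrier

/-! ### Optimality of densities `Ψ / w` -/

namespace SpectrumApproximation

theorem ae_abs_le (Φ : Lp ℝ ∞ circleMeasure) : ∃ C : ℝ, 0 < C ∧ ∀ᵐ θ ∂circleMeasure, |Φ θ| ≤ C := by
  refine ⟨‖Φ‖ + 1, by positivity, ?_⟩
  have hfin : eLpNormEssSup Φ circleMeasure ≠ ∞ := by
    rw [← eLpNorm_exponent_top]; exact (Lp.memLp Φ).2.ne
  filter_upwards [ae_le_eLpNormEssSup (f := Φ) (μ := circleMeasure)] with θ hθ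
  have h := ENNReal.toReal_mono hfin hθ
  rw [toReal_enorm, Real.norm_eq_abs] at h
  rw [Lp.norm_def, eLpNorm_exponent_top]
  linarith

theorem integrable_Lp_top (Φ : Lp ℝ ∞ circleMeasure) : Integrable Φ circleMeasure :=
  (Lp.memLp Φ).integrable le_top

theorem memLp_top_log {Φ : Lp ℝ ∞ circleMeasure} (hΦ : Φ ∈ spectralDensities) :
    MemLp (fun θ => Real.log (Φ θ)) ∞ circleMeasure := by
  obtain ⟨c, hc, hcΦ⟩ := hΦ
  obtain ⟨C, hC, hCΦ⟩ := ae_abs_le Φ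
  refine memLp_top_of_bound
    (Real.measurable_log.comp_aemeasurable
      (Lp.aestronglyMeasurable Φ).aemeasurable).aestronglyMeasurable (C + c⁻¹) ?_
  filter_upwards [hcΦ, hCΦ] with θ h1 h2
  have h0 : 0 < Φ θ := hc.trans_le h1
  have h3 := Real.log_le_sub_one_of_pos h0
  have h4 := Real.one_sub_inv_le_log_of_pos h0
  have h5 : (Φ θ)⁻¹ ≤ c⁻¹ := inv_anti₀ hc h1
  have h6 : 0 < c⁻¹ := inv_pos.2 hc
  rw [Real.norm_eq_abs, abs_le]
  constructor <;> linarith [(abs_le.1 h2).2]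

theorem integrable_klDist {Ψ Φ : Lp ℝ ∞ circleMeasure} (hΨ : Ψ ∈ spectralDensities)
    (hΦ : Φ ∈ spectralDensities) :
    Integrable (fun θ => Ψ θ * Real.log (Ψ θ / Φ θ)) circleMeasure := by
  have h := (integrable_Lp_top Ψ).mul_of_top_left
    ((memLp_top_log hΨ).sub (memLp_top_log hΦ))
  refine h.congr ?_
  obtain ⟨c, hc, hcΨ⟩ := hΨ
  obtain ⟨c', hc', hcΦ⟩ := hΦ
  filter_upwards [hcΨ, hcΦ] with θ h1 h2
  rw [Real.log_div (hc.trans_le h1).ne' (hc'.trans_le h2).ne']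
  rfl

/-- A density of the form `Ψ / w` is the strict minimizer of `D(Ψ‖·)` among the densities with the
same integral against `w`. -/
theorem klDist_le_of_integral_mul_eq {Ψ Φ₀ Φ : Lp ℝ ∞ circleMeasure} (hΨ : Ψ ∈ spectralDensities)
    (hΦ₀ : Φ₀ ∈ spectralDensities) (hΦ : Φ ∈ spectralDensities) {w : C(𝕋, ℝ)}
    (hw : ∀ θ, 0 < w θ) (hΦ₀w : Φ₀ =ᵐ[circleMeasure] fun θ => Ψ θ / w θ)
    (hint : ∫ θ, Φ θ * w θ ∂circleMeasure = ∫ θ, Φ₀ θ * w θ ∂circleMeasure) :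
    klDist Ψ Φ₀ ≤ klDist Ψ Φ ∧ (klDist Ψ Φ ≤ klDist Ψ Φ₀ → Φ = Φ₀) := by
  have hΦ₀int : ∫ θ, Φ₀ θ * w θ ∂circleMeasure = ∫ θ, Ψ θ ∂circleMeasure := by
    refine integral_congr_ae ?_
    filter_upwards [hΦ₀w] with θ h
    rw [h, div_mul_cancel₀ _ (hw θ).ne']
  -- Almost everywhere `h = Ψ (x - 1 - log x)` with `x = Φ w / Ψ`. The first bracket integrates to
  -- zero, so `h` integrates to the difference of divergences.
  set h : 𝕋 → ℝ := fun θ => (Φ θ * w θ - Ψ θ)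
    - (Ψ θ * Real.log (Ψ θ / Φ₀ θ) - Ψ θ * Real.log (Ψ θ / Φ θ)) with hh
  have i1 := ContinuousMap.integrable_mul (integrable_Lp_top Φ) w
  have i2 := integrable_Lp_top Ψ
  have i3 := integrable_klDist hΨ hΦ₀
  have i4 := integrable_klDist hΨ hΦ
  have hi : Integrable h circleMeasure := (i1.sub i2).sub (i3.sub i4)
  have hval : ∫ θ, h θ ∂circleMeasure = klDist Ψ Φ - klDist Ψ Φ₀ := by
    refine (integral_sub (i1.sub i2) (i3.sub i4)).trans
      ((congrArg₂ (· - ·) (integral_sub i1 i2) (integral_sub i3 i4)).trans ?_)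
    rw [hint, hΦ₀int, klDist, klDist]
    ring
  obtain ⟨a, ha, haΨ⟩ := hΨ
  obtain ⟨b, hb, hbΦ⟩ := hΦ
  have hpt : ∀ᵐ θ ∂circleMeasure, 0 < Φ θ * w θ / Ψ θ ∧ 0 < Ψ θ ∧
      h θ = Ψ θ * (Φ θ * w θ / Ψ θ - 1 - Real.log (Φ θ * w θ / Ψ θ)) := by
    filter_upwards [haΨ, hbΦ, hΦ₀w] with θ h1 h2 h3
    have hΨθ := ha.trans_le h1
    have hΦθ := hb.trans_le h2
    have hwθ := hw θ
    refine ⟨by positivity, hΨθ, ?_⟩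
    have e1 : Ψ θ / Φ₀ θ = w θ := by rw [h3]; field_simp
    rw [hh]
    simp only [e1]
    rw [Real.log_div (mul_pos hΦθ hwθ).ne' hΨθ.ne', Real.log_mul hΦθ.ne' hwθ.ne',
      Real.log_div hΨθ.ne' hΦθ.ne']
    field_simp
    ring
  have hnonneg : 0 ≤ᵐ[circleMeasure] h := by
    filter_upwards [hpt] with θ ⟨h1, h2, h3⟩
    rw [h3]
    exact mul_nonneg h2.le (sub_nonneg.2 (Real.log_le_sub_one_of_pos h1))
  have h0 := integral_nonneg_of_ae hnonneg
  rw [hval] at h0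
  refine ⟨sub_nonneg.1 h0, fun hle => ?_⟩
  have hz : h =ᵐ[circleMeasure] 0 := by
    rw [← integral_eq_zero_iff_of_nonneg_ae hnonneg hi, hval]
    linarith
  refine Lp.ext ?_
  filter_upwards [hpt, hz, hΦ₀w] with θ ⟨h1, h2, h3⟩ h4 h5
  rw [h4] at h3
  have h6 : Φ θ * w θ / Ψ θ = 1 := by
    by_contra hne
    have := Real.log_lt_sub_one_of_pos h1 hne
    have := mul_pos h2 (sub_pos.2 this)
    exact absurd h3 this.ne
  rw [div_eq_one_iff_eq h2.ne'] at h6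
  rw [h5, eq_div_iff (hw θ).ne', h6]

theorem exists_pos_le_of_forall_pos {w : C(𝕋, ℝ)} (hw : ∀ θ, 0 < w θ) :
    ∃ β : ℝ, 0 < β ∧ ∀ θ, β ≤ w θ := by
  obtain ⟨θ₀, -, h⟩ := isCompact_univ.exists_isMinOn (Set.univ_nonempty (α := 𝕋))
    w.continuous.continuousOn
  exact ⟨w θ₀, hw θ₀, fun θ => h (Set.mem_univ θ)⟩

theorem exists_mem_spectralDensities_ae_eq_div {Ψ : Lp ℝ ∞ circleMeasure}
    (hΨ : Ψ ∈ spectralDensities) {w : C(𝕋, ℝ)} (hw : ∀ θ, 0 < w θ) :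
    ∃ Φ ∈ spectralDensities, Φ =ᵐ[circleMeasure] fun θ => Ψ θ / w θ := by
  obtain ⟨a, ha, haΨ⟩ := hΨ
  obtain ⟨C, hC, hCΨ⟩ := ae_abs_le Ψ
  obtain ⟨β, hβ, hβw⟩ := exists_pos_le_of_forall_pos hw
  have hmem : MemLp (fun θ => Ψ θ / w θ) ∞ circleMeasure := by
    refine memLp_top_of_bound ((Lp.aestronglyMeasurable Ψ).aemeasurable.div
      w.continuous.measurable.aemeasurable).aestronglyMeasurable (C / β) ?_
    filter_upwards [hCΨ] with θ h1
    rw [norm_div, Real.norm_eq_abs, Real.norm_of_nonneg (hw θ).le]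
    gcongr
    exact hβw θ
  refine ⟨hmem.toLp, ⟨a / (‖w‖ + 1), by positivity, ?_⟩, hmem.coeFn_toLp⟩
  filter_upwards [hmem.coeFn_toLp, haΨ] with θ h1 h2
  rw [h1]
  have h3 := hw θ
  have h4 : w θ ≤ ‖w‖ + 1 :=
    ((le_abs_self _).trans (w.norm_coe_le_norm θ)).trans (by linarith)
  have h5 := ha.trans_le h2
  gcongr

/-! ### Existence, uniqueness and form of the solution -/

section Solution

open Matrix

variable {n : ℕ} {A : Matrix (Fin n) (Fin n) ℂ} (hA : IsStabilityMatrix A)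
  {B : Matrix (Fin n) (Fin 1) ℂ} {Ψ : Lp ℝ ∞ circleMeasure} {S : Matrix (Fin n) (Fin n) ℂ}

theorem integrable_continuousMap (Φ : C(𝕋, ℝ)) : Integrable Φ circleMeasure := by
  simpa using ContinuousMap.integrable_mul (integrable_const (μ := circleMeasure) (1 : ℝ)) Φ

/-- Existence of the dual variable, for data in the range of `Γ`. -/
theorem exists_dual (hB : B ≠ 0) (hAB : IsReachable A B) (hΨ : Ψ ∈ spectralDensities)
    (hS : S ∈ posRangeGamma A B) :
    ∃ Λ : Matrix (Fin n) (Fin n) ℂ, (∀ θ, 0 < quadraticFun hA B Λ θ) ∧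
      ∀ Λ' : Matrix (Fin n) (Fin n) ℂ,
        ∫ θ, Ψ θ * (quadraticFun hA B Λ' θ / quadraticFun hA B Λ θ) ∂circleMeasure
          = (Λ' * S).trace.re := by
  obtain ⟨⟨Φ, rfl⟩, hpd⟩ := hS
  obtain ⟨l, hl0, hl⟩ := hpd.exists_pos_mul_sum_norm_sq_le
  obtain ⟨K, hK0, hK⟩ := exists_sum_norm_sq_transferVec_le B hA
  obtain ⟨a, ha, haΨ⟩ := hΨ
  have hΦ := integrable_continuousMap Φ
  obtain ⟨w, ⟨Λ, rfl⟩, hwpos, hwu⟩ := exists_pos_integral_div_eq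
    (W := LinearMap.range (quadraticFun hA B)) (integrable_Lp_top Ψ) ha haΨ
    (by rintro _ ⟨Λ, rfl⟩ h0 θ₀ hθ₀
        exact lintegral_inv_quadraticFun_eq_top hA hB hAB hΦ hl0 hl h0 hθ₀)
    ⟨1, rfl⟩ (quadraticFun_one_pos hA B hB) (ContinuousMap.integralMul hΦ)
    (c := l / K) (div_pos hl0 hK0)
    (by rintro _ ⟨Λ, rfl⟩ h0
        rw [div_mul_eq_mul_div, div_le_iff₀' hK0, ContinuousMap.integralMul_apply,
          integral_mul_quadraticFun hA B hΦ]
        exact mul_norm_quadraticFun_le hA hB hAB hΦ hl0.le hl hK h0)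
  refine ⟨Λ, hwpos, fun Λ' => ?_⟩
  rw [hwu _ ⟨Λ', rfl⟩, ContinuousMap.integralMul_apply, integral_mul_quadraticFun hA B hΦ]

/-- The dual equations say exactly that `Ψ / w` is feasible, and feasibility fixes the integral
against `w` itself, as needed for the strict comparison. -/
theorem isKLSolution_iff (hΨ : Ψ ∈ spectralDensities) {Λ : Matrix (Fin n) (Fin n) ℂ}
    (hpos : ∀ θ, 0 < quadraticFun hA B Λ θ)
    (hdual : ∀ Λ' : Matrix (Fin n) (Fin n) ℂ,
      ∫ θ, Ψ θ * (quadraticFun hA B Λ' θ / quadraticFun hA B Λ θ) ∂circleMeasure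
        = (Λ' * S).trace.re) (Φ : Lp ℝ ∞ circleMeasure) :
    IsKLSolution A B Ψ S Φ ↔
      Φ =ᵐ[circleMeasure] fun θ => Ψ θ / quadraticFun hA B Λ θ := by
  obtain ⟨Φ₀, hΦ₀, hΦ₀w⟩ := exists_mem_spectralDensities_ae_eq_div hΨ hpos
  have hfeas : Φ₀ ∈ feasible A B S := by
    refine ⟨hΦ₀, (moment_eq_iff hA B (integrable_Lp_top Φ₀) S).2 fun Λ' => ?_⟩
    rw [← hdual]
    refine integral_congr_ae ?_
    filter_upwards [hΦ₀w] with θ h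
    rw [h]; ring
  have hcmp : ∀ Φ ∈ feasible A B S,
      klDist Ψ Φ₀ ≤ klDist Ψ Φ ∧ (klDist Ψ Φ ≤ klDist Ψ Φ₀ → Φ = Φ₀) := fun Φ hΦ =>
    klDist_le_of_integral_mul_eq hΨ hΦ₀ hΦ.1 hpos hΦ₀w
      (((moment_eq_iff hA B (integrable_Lp_top Φ) S).1 hΦ.2 Λ).trans
        ((moment_eq_iff hA B (integrable_Lp_top Φ₀) S).1 hfeas.2 Λ).symm)
  constructor
  · rintro ⟨hΦ, hmin⟩
    rw [(hcmp Φ hΦ).2 (hmin Φ₀ hfeas)]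
    exact hΦ₀w
  · intro h
    rw [show Φ = Φ₀ from Lp.ext (h.trans hΦ₀w.symm)]
    exact ⟨hfeas, fun Φ' hΦ' => (hcmp Φ' hΦ').1⟩

theorem existsUnique_isKLSolution (hA : IsStabilityMatrix A) (hB : B ≠ 0) (hAB : IsReachable A B)
    (hΨ : Ψ ∈ spectralDensities) (hS : S ∈ posRangeGamma A B) :
    ∃! Φ : Lp ℝ ∞ circleMeasure, IsKLSolution A B Ψ S Φ := by
  obtain ⟨Λ, hpos, hdual⟩ := exists_dual hA hB hAB hΨ hS
  obtain ⟨Φ₀, -, hΦ₀w⟩ := exists_mem_spectralDensities_ae_eq_div hΨ hpos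
  refine ⟨Φ₀, (isKLSolution_iff hA hΨ hpos hdual Φ₀).2 hΦ₀w, fun Φ hΦ => ?_⟩
  exact Lp.ext (((isKLSolution_iff hA hΨ hpos hdual Φ).1 hΦ).trans hΦ₀w.symm)

end Solution

end SpectrumApproximation

/-! ### Perturbation estimates -/

theorem LinearMap.exists_norm_le_of_finiteDimensional {E F : Type*} [NormedAddCommGroup E]
    [NormedSpace ℝ E] [FiniteDimensional ℝ E] [NormedAddCommGroup F] [NormedSpace ℝ F]
    (f : E →ₗ[ℝ] F) : ∃ C : ℝ, 0 ≤ C ∧ ∀ x, ‖f x‖ ≤ C * ‖x‖ :=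
  ⟨‖LinearMap.toContinuousLinearMap f‖, norm_nonneg _,
    (LinearMap.toContinuousLinearMap f).le_opNorm⟩

/-- On a finite-dimensional space of continuous functions, the sup norm is dominated by the
`L²` norm. -/
theorem exists_mul_norm_sq_le_integral_sq {X : Type*} [TopologicalSpace X] [CompactSpace X]
    [MeasurableSpace X] [BorelSpace X] {μ : Measure X} [IsFiniteMeasure μ] [μ.IsOpenPosMeasure]
    (W : Submodule ℝ C(X, ℝ)) [FiniteDimensional ℝ W] :
    ∃ k : ℝ, 0 < k ∧ ∀ u ∈ W, k * ‖u‖ ^ 2 ≤ ∫ x, u x ^ 2 ∂μ := by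
  have hpos : ∀ u : C(X, ℝ), u ≠ 0 → 0 < ∫ x, u x ^ 2 ∂μ := fun u hu => by
    obtain ⟨x, hx⟩ := DFunLike.ne_iff.1 hu
    exact (u.continuous.pow 2).integral_pos_of_hasCompactSupport_nonneg_nonzero (x := x)
      (HasCompactSupport.of_compactSpace _) (fun y => sq_nonneg (u y)) (pow_ne_zero 2 hx)
  have hcont : Continuous fun u : C(X, ℝ) => ∫ x, u x ^ 2 ∂μ := by
    have h := (ContinuousMap.integralMul (integrable_const (μ := μ) (1 : ℝ))).continuous.comp
      (continuous_pow 2 (M := C(X, ℝ)))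
    refine h.congr fun u => ?_
    simp [ContinuousMap.integralMul_apply]
  have hc : IsCompact ({u : C(X, ℝ) | u ∈ W ∧ ‖u‖ ≤ 1} ∩ {u | ‖u‖ = 1}) :=
    (W.isCompact_inter_norm_le 1).inter_right (isClosed_eq continuous_norm continuous_const)
  have hscale : ∀ u ∈ W, u ≠ 0 → ‖u‖⁻¹ • u ∈
      {u : C(X, ℝ) | u ∈ W ∧ ‖u‖ ≤ 1} ∩ {u | ‖u‖ = 1} := fun u hu hu0 => by
    have : ‖‖u‖⁻¹ • u‖ = 1 := by
      rw [norm_smul, norm_inv, norm_norm, inv_mul_cancel₀ (norm_ne_zero_iff.2 hu0)]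
    exact ⟨⟨W.smul_mem _ hu, this.le⟩, this⟩
  rcases Set.eq_empty_or_nonempty
    ({u : C(X, ℝ) | u ∈ W ∧ ‖u‖ ≤ 1} ∩ {u | ‖u‖ = 1}) with he | hne
  · refine ⟨1, one_pos, fun u hu => ?_⟩
    have : u = 0 := by
      by_contra hu0
      have := hscale u hu hu0
      rw [he] at this
      exact this.elim
    simp [this]
  obtain ⟨u₀, ⟨-, h1⟩, hmin⟩ := hc.exists_isMinOn hne hcont.continuousOn
  have h1 : ‖u₀‖ = 1 := h1
  refine ⟨∫ x, u₀ x ^ 2 ∂μ, hpos u₀ (norm_ne_zero_iff.1 (by rw [h1]; exact one_ne_zero)),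
    fun u hu => ?_⟩
  rcases eq_or_ne u 0 with rfl | hu0
  · simp
  have h : ∫ x, u₀ x ^ 2 ∂μ ≤ ∫ x, (‖u‖⁻¹ • u) x ^ 2 ∂μ := hmin (hscale u hu hu0)
  have hn : 0 < ‖u‖ := norm_pos_iff.2 hu0
  have e : ∫ x, (‖u‖⁻¹ • u) x ^ 2 ∂μ = (‖u‖ ^ 2)⁻¹ * ∫ x, u x ^ 2 ∂μ := by
    rw [← integral_const_mul]
    simp only [ContinuousMap.smul_apply, smul_eq_mul, mul_pow, inv_pow]
  rw [e] at h
  calc (∫ x, u₀ x ^ 2 ∂μ) * ‖u‖ ^ 2 ≤ ((‖u‖ ^ 2)⁻¹ * ∫ x, u x ^ 2 ∂μ) * ‖u‖ ^ 2 := by gcongr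
    _ = _ := by field_simp

namespace SpectrumApproximation

section Perturbation

open Matrix

variable {n : ℕ} {A : Matrix (Fin n) (Fin n) ℂ} (hA : IsStabilityMatrix A)
  (B : Matrix (Fin n) (Fin 1) ℂ)

/-- `Λ ↦ Re (G* Λ G)` has a kernel, so `Λ` itself is not controlled by its function. A linear
section over the finite-dimensional range picks a controlled representative. -/
theorem exists_bounded_quadraticFun_preimage :
    ∃ C : ℝ, 0 ≤ C ∧ ∀ Λ : Matrix (Fin n) (Fin n) ℂ, ∃ Λ' : Matrix (Fin n) (Fin n) ℂ,
      quadraticFun hA B Λ' = quadraticFun hA B Λ ∧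
        ∀ i j, ‖Λ' i j‖ ≤ C * ‖quadraticFun hA B Λ‖ := by
  set q := quadraticFun hA B
  obtain ⟨s, hs⟩ := q.rangeRestrict.exists_rightInverse_of_surjective q.range_rangeRestrict
  choose f hf0 hf using fun i j => LinearMap.exists_norm_le_of_finiteDimensional
    ((Matrix.entryLinearMap ℝ ℂ i j).comp s)
  refine ⟨∑ i, ∑ j, f i j, Finset.sum_nonneg fun i _ => Finset.sum_nonneg fun j _ => hf0 i j,
    fun Λ => ⟨s (q.rangeRestrict Λ), ?_, fun i j => ?_⟩⟩
  · exact congrArg Subtype.val (LinearMap.congr_fun hs (q.rangeRestrict Λ))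
  · refine (hf i j (q.rangeRestrict Λ)).trans ?_
    have h1 : f i j ≤ ∑ i, ∑ j, f i j :=
      (Finset.single_le_sum (f := fun j => f i j) (fun j _ => hf0 i j)
        (Finset.mem_univ j)).trans
      (Finset.single_le_sum (f := fun i => ∑ j, f i j)
        (fun i _ => Finset.sum_nonneg fun j _ => hf0 i j) (Finset.mem_univ i))
    exact mul_le_mul_of_nonneg_right h1 (norm_nonneg _)

theorem abs_re_trace_mul_le {Λ S : Matrix (Fin n) (Fin n) ℂ} {a r : ℝ} (ha : 0 ≤ a)
    (hΛ : ∀ i j, ‖Λ i j‖ ≤ a) (hS : ∀ i j, ‖S i j‖ ≤ r) :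
    |(Λ * S).trace.re| ≤ n ^ 2 * (a * r) := by
  refine (Complex.abs_re_le_norm _).trans ?_
  rw [trace]
  refine (norm_sum_le _ _).trans ?_
  calc ∑ i, ‖(Λ * S).diag i‖ ≤ ∑ _i : Fin n, ∑ _j : Fin n, a * r := by
        refine Finset.sum_le_sum fun i _ => ?_
        rw [diag_apply, mul_apply]
        refine (norm_sum_le _ _).trans (Finset.sum_le_sum fun j _ => ?_)
        rw [norm_mul]
        exact mul_le_mul (hΛ i j) (hS j i) (norm_nonneg _) ha
    _ = _ := by simp; ring

theorem neg_le_re_quadraticForm {S : Matrix (Fin n) (Fin n) ℂ} {r : ℝ}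
    (hS : ∀ i j, ‖S i j‖ ≤ r) (v : Fin n → ℂ) :
    -(n ^ 2 * r * ∑ i, ‖v i‖ ^ 2) ≤ (star v ⬝ᵥ S *ᵥ v).re := by
  have h1 : ∀ i, ‖v i‖ ^ 2 ≤ ∑ i, ‖v i‖ ^ 2 := fun i =>
    Finset.single_le_sum (f := fun i => ‖v i‖ ^ 2) (fun _ _ => by positivity) (Finset.mem_univ i)
  have h2 : (vecMulVec v (star v) * S).trace = star v ⬝ᵥ S *ᵥ v := by
    have := trace_vecMulVec_mul_re (star v) S
    rwa [star_star] at this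
  have h3 := abs_re_trace_mul_le (Λ := vecMulVec v (star v)) (S := S)
    (a := ∑ i, ‖v i‖ ^ 2) (Finset.sum_nonneg fun _ _ => by positivity) (fun i j => by
      rw [vecMulVec_apply, norm_mul, Pi.star_apply, norm_star]
      nlinarith [h1 i, h1 j, sq_nonneg (‖v i‖ - ‖v j‖)]) hS
  rw [h2] at h3
  have := (abs_le.1 h3).1
  linarith

theorem add_mem_rangeGamma {S T : Matrix (Fin n) (Fin n) ℂ} (hA : IsStabilityMatrix A)
    (hS : S ∈ rangeGamma A B) (hT : T ∈ rangeGamma A B) : S + T ∈ rangeGamma A B := by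
  obtain ⟨Φ, rfl⟩ := hS
  obtain ⟨Φ', rfl⟩ := hT
  refine ⟨Φ + Φ', ?_⟩
  have h1 := integrable_moment_entry hA B (integrable_continuousMap Φ)
  have h2 := integrable_moment_entry hA B (integrable_continuousMap Φ')
  ext i j
  change moment A B (Φ + Φ' : C(𝕋, ℝ)) i j = moment A B Φ i j + moment A B Φ' i j
  rw [moment_apply, moment_apply, moment_apply, ← integral_add (h1 i j) (h2 i j)]
  refine integral_congr_ae (.of_forall fun θ => ?_)
  simp only [ContinuousMap.add_apply, Complex.ofReal_add]
  ring

theorem isHermitian_of_mem_rangeGamma {S : Matrix (Fin n) (Fin n) ℂ}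
    (hS : S ∈ rangeGamma A B) : S.IsHermitian := by
  obtain ⟨Φ, rfl⟩ := hS
  ext i j
  change star (moment A B Φ j i) = moment A B Φ i j
  rw [moment_apply, moment_apply, ← starRingEnd_apply, ← integral_conj]
  refine integral_congr_ae (.of_forall fun θ => ?_)
  simp only [map_mul, Complex.conj_ofReal, ← starRingEnd_apply, Complex.conj_conj]
  ring

end Perturbation

/-! ### Continuous dependence on the data -/

section Dual

open Matrix

variable {n : ℕ} {A : Matrix (Fin n) (Fin n) ℂ} (hA : IsStabilityMatrix A)
  {B : Matrix (Fin n) (Fin 1) ℂ} {Ψ : Lp ℝ ∞ circleMeasure} {S : Matrix (Fin n) (Fin n) ℂ}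

/-- A bound for the dual variable. -/
theorem mul_norm_dual_le (hB : B ≠ 0) (hAB : IsReachable A B) (hS : S ∈ rangeGamma A B) {l : ℝ}
    (hl0 : 0 ≤ l) (hl : ∀ v : Fin n → ℂ, l * ∑ i, ‖v i‖ ^ 2 ≤ (star v ⬝ᵥ S *ᵥ v).re)
    {K : ℝ} (hK : ∀ θ, ∑ i, ‖transferVec B A θ i‖ ^ 2 ≤ K)
    {Λ : Matrix (Fin n) (Fin n) ℂ} (hpos : ∀ θ, 0 < quadraticFun hA B Λ θ)
    (hdual : ∀ Λ' : Matrix (Fin n) (Fin n) ℂ,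
      ∫ θ, Ψ θ * (quadraticFun hA B Λ' θ / quadraticFun hA B Λ θ) ∂circleMeasure
        = (Λ' * S).trace.re) :
    l * ‖quadraticFun hA B Λ‖ ≤ K * ∫ θ, Ψ θ ∂circleMeasure := by
  obtain ⟨Φ, rfl⟩ := hS
  refine (mul_norm_quadraticFun_le hA hB hAB (integrable_continuousMap Φ) hl0 hl hK
    fun θ => (hpos θ).le).trans (le_of_eq ?_)
  rw [← hdual]
  congr 1
  refine integral_congr_ae (.of_forall fun θ => ?_)
  simp only [div_self (hpos θ).ne', mul_one]

/-- The distance between two dual variables is controlled by the distance between the data. -/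
theorem integral_sq_sub_dual_le {a R : ℝ} (ha : 0 < a) (hΨa : ∀ᵐ θ ∂circleMeasure, a ≤ Ψ θ)
    (hR : 0 < R) {T : Matrix (Fin n) (Fin n) ℂ}
    {Λ Λ' : Matrix (Fin n) (Fin n) ℂ} (hpos : ∀ θ, 0 < quadraticFun hA B Λ θ)
    (hpos' : ∀ θ, 0 < quadraticFun hA B Λ' θ)
    (hΛR : ‖quadraticFun hA B Λ‖ ≤ R) (hΛR' : ‖quadraticFun hA B Λ'‖ ≤ R)
    (hdual : ∀ M : Matrix (Fin n) (Fin n) ℂ,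
      ∫ θ, Ψ θ * (quadraticFun hA B M θ / quadraticFun hA B Λ θ) ∂circleMeasure
        = (M * S).trace.re)
    (hdual' : ∀ M : Matrix (Fin n) (Fin n) ℂ,
      ∫ θ, Ψ θ * (quadraticFun hA B M θ / quadraticFun hA B Λ' θ) ∂circleMeasure
        = (M * (S + T)).trace.re)
    {M : Matrix (Fin n) (Fin n) ℂ} (hM : quadraticFun hA B M = quadraticFun hA B (Λ - Λ')) :
    a / R ^ 2 * ∫ θ, quadraticFun hA B (Λ - Λ') θ ^ 2 ∂circleMeasure ≤ (M * T).trace.re := by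
  set w := quadraticFun hA B Λ
  set w' := quadraticFun hA B Λ'
  have hu : quadraticFun hA B (Λ - Λ') = w - w' := map_sub _ _ _
  rw [hu] at hM ⊢
  have hint : ∀ {v : C(𝕋, ℝ)}, (∀ θ, 0 < v θ) →
      Integrable (fun θ => Ψ θ * ((w - w') θ / v θ)) circleMeasure := fun {v} hv =>
    ContinuousMap.integrable_mul (integrable_Lp_top Ψ)
      ⟨fun θ => (w - w') θ / v θ, (w - w').continuous.div v.continuous fun θ => (hv θ).ne'⟩
  have h1 : (M * T).trace.re = ∫ θ, (Ψ θ * ((w - w') θ / w' θ) - Ψ θ * ((w - w') θ / w θ))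
      ∂circleMeasure := by
    rw [integral_sub (hint hpos') (hint hpos), ← hM, hdual, hdual', Matrix.mul_add, trace_add,
      Complex.add_re]
    ring
  rw [h1, ← integral_const_mul]
  refine integral_mono_of_nonneg (.of_forall fun θ => by positivity)
    ((hint hpos').sub (hint hpos)) ?_
  filter_upwards [hΨa] with θ hθ
  have p1 := hpos θ
  have p2 := hpos' θ
  have b1 : w θ ≤ R := ((le_abs_self _).trans (w.norm_coe_le_norm θ)).trans hΛR
  have b2 : w' θ ≤ R := ((le_abs_self _).trans (w'.norm_coe_le_norm θ)).trans hΛR'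
  -- This is the strong monotonicity of `w ↦ -1 / w`, quantified by `w, w' ≤ R`.
  have e : Ψ θ * ((w - w') θ / w' θ) - Ψ θ * ((w - w') θ / w θ)
      = Ψ θ / (w θ * w' θ) * (w - w') θ ^ 2 := by
    rw [ContinuousMap.sub_apply]
    field_simp
  rw [e, pow_two R]
  have h5 := ha.trans_le hθ
  gcongr

theorem norm_sub_le_of_ae_eq_div {Φ Φ' : Lp ℝ ∞ circleMeasure} {w w' : C(𝕋, ℝ)} {β C : ℝ}
    (hβ : 0 < β) (hC : 0 ≤ C) (hΨC : ∀ᵐ θ ∂circleMeasure, |Ψ θ| ≤ C) (hw : ∀ θ, β ≤ w θ)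
    (hww' : ‖w - w'‖ ≤ β / 2)
    (hΦ : Φ =ᵐ[circleMeasure] fun θ => Ψ θ / w θ)
    (hΦ' : Φ' =ᵐ[circleMeasure] fun θ => Ψ θ / w' θ) :
    ‖Φ' - Φ‖ ≤ 2 * C / β ^ 2 * ‖w - w'‖ := by
  have h := Lp.norm_le_of_ae_bound (f := Φ' - Φ) (C := 2 * C / β ^ 2 * ‖w - w'‖) (by positivity) ?_
  · simpa using h
  filter_upwards [Lp.coeFn_sub Φ' Φ, hΦ, hΦ', hΨC] with θ h1 h2 h3 h4
  have h5 : |w θ - w' θ| ≤ ‖w - w'‖ := (w - w').norm_coe_le_norm θ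
  have h6 := hw θ
  have h7 : β / 2 ≤ w' θ := by linarith [(abs_le.1 (h5.trans hww')).2]
  have p1 : 0 < w θ := hβ.trans_le h6
  have p2 : 0 < w' θ := (half_pos hβ).trans_le h7
  rw [h1, Pi.sub_apply, h2, h3]
  have e : Ψ θ / w' θ - Ψ θ / w θ = Ψ θ * (w θ - w' θ) / (w θ * w' θ) := by field_simp
  rw [e, Real.norm_eq_abs, abs_div, abs_mul, abs_of_pos (mul_pos p1 p2)]
  calc |Ψ θ| * |w θ - w' θ| / (w θ * w' θ) ≤ C * ‖w - w'‖ / (β * (β / 2)) := by gcongr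
    _ = _ := by field_simp

/-- Continuous dependence of the solution on the data, with the size of the perturbation measured
by its entries. -/
theorem exists_delta_of_isKLSolution (hA : IsStabilityMatrix A) (hB : B ≠ 0)
    (hAB : IsReachable A B) (hΨ : Ψ ∈ spectralDensities) (hS : S ∈ posRangeGamma A B)
    {Φ : Lp ℝ ∞ circleMeasure} (hΦ : IsKLSolution A B Ψ S Φ) {ε : ℝ} (hε : 0 < ε) :
    ∃ δ : ℝ, 0 < δ ∧ ∀ T ∈ rangeGamma A B, (∀ i j, ‖T i j‖ ≤ δ) →
      S + T ∈ posRangeGamma A B ∧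
        ∀ Φ' : Lp ℝ ∞ circleMeasure, IsKLSolution A B Ψ (S + T) Φ' → ‖Φ' - Φ‖ < ε := by
  obtain ⟨Λ, hpos, hdual⟩ := exists_dual hA hB hAB hΨ hS
  have hΦw := (isKLSolution_iff hA hΨ hpos hdual Φ).1 hΦ
  obtain ⟨l, hl0, hl⟩ := hS.2.exists_pos_mul_sum_norm_sq_le
  obtain ⟨K, hK0, hK⟩ := exists_sum_norm_sq_transferVec_le B hA
  obtain ⟨a, ha, haΨ⟩ := id hΨ
  obtain ⟨b, hb, hbΨ⟩ := ae_abs_le Ψ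
  obtain ⟨β, hβ, hβw⟩ := exists_pos_le_of_forall_pos hpos
  obtain ⟨k, hk, hkW⟩ := exists_mul_norm_sq_le_integral_sq (μ := circleMeasure)
    (LinearMap.range (quadraticFun hA B))
  obtain ⟨C, hC, hCpre⟩ := exists_bounded_quadraticFun_preimage hA B
  have hm : 0 ≤ ∫ θ, Ψ θ ∂circleMeasure :=
    integral_nonneg_of_ae (haΨ.mono fun θ h => ha.le.trans h)
  -- One bound for both multipliers: the forms of `S` and `S + T` are at least `l / 2`. The added
  -- `1` makes `R` positive.
  set R : ℝ := K * (∫ θ, Ψ θ ∂circleMeasure) / (l / 2) + 1 with hR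
  have hR0 : 0 < R := by positivity
  -- `D` bounds the change of the dual variable per unit of perturbation
  set D : ℝ := n ^ 2 * C * R ^ 2 / (a * k) with hD
  have hD0 : 0 ≤ D := by positivity
  -- Target for `‖w - w'‖`: `β / 2` keeps `w' ≥ β / 2`, and the second term makes the final bound `ε
  -- / 2`.
  set γ : ℝ := min (β / 2) (ε * β ^ 2 / (4 * b))
  have hγ0 : 0 < γ := by positivity
  refine ⟨min (l / 2 / (n ^ 2 + 1)) (γ / (D + 1)), by positivity, fun T hT hTδ => ?_⟩
  have hT1 : ∀ i j, ‖T i j‖ ≤ l / 2 / (n ^ 2 + 1) := fun i j => (hTδ i j).trans (min_le_left _ _)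
  have hT2 : ∀ i j, ‖T i j‖ ≤ γ / (D + 1) := fun i j => (hTδ i j).trans (min_le_right _ _)
  have hform : ∀ v : Fin n → ℂ, l / 2 * ∑ i, ‖v i‖ ^ 2 ≤ (star v ⬝ᵥ (S + T) *ᵥ v).re := by
    intro v
    have h1 := neg_le_re_quadraticForm hT1 v
    have h2 : (n : ℝ) ^ 2 * (l / 2 / (n ^ 2 + 1)) ≤ l / 2 := by
      rw [mul_div_assoc', div_le_iff₀ (by positivity)]
      nlinarith
    have h3 : (0 : ℝ) ≤ ∑ i, ‖v i‖ ^ 2 := by positivity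
    rw [add_mulVec, dotProduct_add, Complex.add_re]
    nlinarith [hl v, mul_le_mul_of_nonneg_right h2 h3]
  have hrange := add_mem_rangeGamma B hA hS.1 hT
  have hS' : S + T ∈ posRangeGamma A B := by
    have hherm := isHermitian_of_mem_rangeGamma B hrange
    refine ⟨hrange, posDef_iff_dotProduct_mulVec.2 ⟨hherm, fun v hv => ?_⟩⟩
    obtain ⟨i, hi⟩ := Function.ne_iff.1 hv
    have hv0 : 0 < ∑ i, ‖v i‖ ^ 2 := Finset.sum_pos' (fun _ _ => by positivity)
      ⟨i, Finset.mem_univ i, pow_pos (norm_pos_iff.2 hi) 2⟩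
    exact Complex.pos_iff.2 ⟨(mul_pos (half_pos hl0) hv0).trans_le (hform v),
      (hherm.im_star_dotProduct_mulVec_self v).symm⟩
  refine ⟨hS', fun Φ' hΦ' => ?_⟩
  obtain ⟨Λ', hpos', hdual'⟩ := exists_dual hA hB hAB hΨ hS'
  have hΦw' := (isKLSolution_iff hA hΨ hpos' hdual' Φ').1 hΦ'
  have hbound : ∀ {x : ℝ}, l / 2 * x ≤ K * ∫ θ, Ψ θ ∂circleMeasure → x ≤ R := fun {x} h => by
    rw [← le_div_iff₀' (half_pos hl0)] at h
    linarith
  have hΛR : ‖quadraticFun hA B Λ‖ ≤ R := hbound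
    (mul_norm_dual_le hA hB hAB hS.1 (half_pos hl0).le (fun v =>
      (mul_le_mul_of_nonneg_right (by linarith) (by positivity)).trans (hl v)) hK hpos hdual)
  have hΛR' : ‖quadraticFun hA B Λ'‖ ≤ R := hbound
    (mul_norm_dual_le hA hB hAB hrange (half_pos hl0).le hform hK hpos' hdual')
  obtain ⟨M, hM, hMC⟩ := hCpre (Λ - Λ')
  have h1 := integral_sq_sub_dual_le hA ha haΨ hR0 hpos hpos' hΛR hΛR' hdual hdual' hM
  have h2 := hkW _ ⟨Λ - Λ', rfl⟩
  have h3 := (le_abs_self _).trans (abs_re_trace_mul_le (by positivity) hMC hT2)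
  set u := quadraticFun hA B (Λ - Λ')
  have huw : u = quadraticFun hA B Λ - quadraticFun hA B Λ' := map_sub _ _ _
  have hun : ‖u‖ ≤ γ := by
    have h4 : a / R ^ 2 * (k * ‖u‖ ^ 2) ≤ n ^ 2 * (C * ‖u‖ * (γ / (D + 1))) :=
      (mul_le_mul_of_nonneg_left h2 (by positivity)).trans (h1.trans h3)
    rcases (norm_nonneg u).eq_or_lt with h0 | h0
    · rw [← h0]; exact hγ0.le
    have h5 : ‖u‖ ≤ D * (γ / (D + 1)) := by
      refine le_of_mul_le_mul_left ?_ (show 0 < a / R ^ 2 * k * ‖u‖ by positivity)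
      calc a / R ^ 2 * k * ‖u‖ * ‖u‖ = a / R ^ 2 * (k * ‖u‖ ^ 2) := by ring
        _ ≤ n ^ 2 * (C * ‖u‖ * (γ / (D + 1))) := h4
        _ = a / R ^ 2 * k * ‖u‖ * (D * (γ / (D + 1))) := by
          have : a / R ^ 2 * k * D = n ^ 2 * C := by rw [hD]; field_simp
          linear_combination (-(‖u‖ * (γ / (D + 1)))) * this
    refine h5.trans ?_
    rw [mul_div_assoc', div_le_iff₀ (by positivity)]
    nlinarith
  rw [huw] at hun
  have h6 := norm_sub_le_of_ae_eq_div hβ hb.le hbΨ hβw (hun.trans (min_le_left _ _)) hΦw hΦw'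
  refine h6.trans_lt ?_
  calc 2 * b / β ^ 2 * ‖quadraticFun hA B Λ - quadraticFun hA B Λ'‖
      ≤ 2 * b / β ^ 2 * (ε * β ^ 2 / (4 * b)) := by
        gcongr
        exact hun.trans (min_le_right _ _)
    _ = ε / 2 := by field_simp; ring
    _ < ε := half_lt_self hε

end Dual

end SpectrumApproximation

theorem Matrix.norm_entry_le_frobenius_norm {m n α : Type*} [Fintype m] [Fintype n]
    [NormedAddCommGroup α] (M : Matrix m n α) (i : m) (j : n) :
    ‖M i j‖ ≤ (Matrix.frobeniusNormedAddCommGroup (m := m) (n := n) (α := α)).norm M := by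
  have h := @Matrix.frobenius_norm_def m n α _ _ _ M
  refine le_of_le_of_eq ?_ h.symm
  rw [← Real.sqrt_eq_rpow]
  refine Real.le_sqrt_of_sq_le ?_
  have h2 : ∀ i j, ‖M i j‖ ^ (2 : ℝ) = ‖M i j‖ ^ 2 := fun i j => Real.rpow_two _
  simp only [h2]
  exact (Finset.single_le_sum (f := fun j => ‖M i j‖ ^ 2) (fun _ _ => by positivity)
      (Finset.mem_univ j)).trans
    (Finset.single_le_sum (f := fun i => ∑ j, ‖M i j‖ ^ 2)
      (fun _ _ => by positivity) (Finset.mem_univ i))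

/- `‖X‖` is the Frobenius norm of a matrix `X`. -/
attribute [local instance] Matrix.frobeniusNormedAddCommGroup
open SpectrumApproximation in
theorem mainTheorem4 {n : ℕ} (A : Matrix (Fin n) (Fin n) ℂ) (B : Matrix (Fin n) (Fin 1) ℂ)
    (hA : IsStabilityMatrix A) (hB : B.rank = 1) (hAB : IsReachable A B)
    (Ψ : Lp ℝ ∞ circleMeasure) (hΨ : Ψ ∈ spectralDensities) :
    -- existence and uniqueness of the solution
    (∀ S ∈ posRangeGamma A B, ∃! Φ : Lp ℝ ∞ circleMeasure, IsKLSolution A B Ψ S Φ) ∧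
    -- continuous dependence on the data, for perturbations in the range of `Γ`
    (∀ S ∈ posRangeGamma A B, ∀ Φ : Lp ℝ ∞ circleMeasure, IsKLSolution A B Ψ S Φ →
      ∀ ε : ℝ, 0 < ε → ∃ δ : ℝ, 0 < δ ∧ ∀ dS ∈ rangeGamma A B, ‖dS‖ < δ →
        S + dS ∈ posRangeGamma A B ∧
        ∀ Φ' : Lp ℝ ∞ circleMeasure, IsKLSolution A B Ψ (S + dS) Φ' → ‖Φ' - Φ‖ < ε) := by
  have hB0 : B ≠ 0 := by
    rintro rfl
    rw [Matrix.rank_zero] at hB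
    exact zero_ne_one hB
  refine ⟨fun S hS => existsUnique_isKLSolution hA hB0 hAB hΨ hS, fun S hS Φ hΦ ε hε => ?_⟩
  obtain ⟨δ, hδ, h⟩ := exists_delta_of_isKLSolution hA hB0 hAB hΨ hS hΦ hε
  exact ⟨δ, hδ, fun T hT hTδ =>
    h T hT fun i j => (T.norm_entry_le_frobenius_norm i j).trans hTδ.le⟩
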